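/- Let $n \geq 2$ be an integer and let $s \in \mathbb R$ satisfy $s - \frac n2 \in (0,1)$. Let $\mathbb S^n \subset \mathbb R^{n+1}$ be the unit sphere with its (non-normalized) surface measure, let $P_\ell$ be the $L^2(\mathbb S^n)$-orthogonal projection onto the spherical harmonics of degree $\ell$, and let $$H^s(\mathbb S^n) = \Big\{ u \in L^2(\mathbb S^n) : \sum_{\ell \ge 0} (1 + \ell(\ell+n-1))^s \|P_\ell u\|_2^2 < \infty \Big\},$$ whose elements (real-valued) are identified with their continuous representatives; $u>0$ means $u(\omega)>0$ for all $\omega \in \mathbb S^n$. For $u, v \in H^s(\mathbb S^n)$ set $$a_{2s}[u,v] = \sum_{\ell=0}^\infty \alpha_{2s}(\ell)\, (P_\ell u, P_\ell v)_{L^2}, \qquad a_{2s}[u] = a_{2s}[u,u], \qquad \alpha_{2s}(\ell) = \frac{\Gamma(\ell + \frac n2 + s)}{\Gamma(\ell + \frac n2 - s)},$$ and let $$\mathcal S_s = (4\pi)^s\, \frac{\Gamma(\frac{n+2s}{2})}{\Gamma(\frac{n-2s}{2})} \left( \frac{\Gamma(\frac n2)}{\Gamma(n)} \right)^{2s/n},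 \qquad \|u\|_{\frac{2n}{n-2s}} = \Big( \int_{\mathbb S^n} u^{\frac{2n}{n-2s}} \, d\omega \Big)^{\frac{n-2s}{2n}} \quad (u > 0).$$ Let $\mathcal M$ be the manifold of all functions $\omega \mapsto c\,(1 - \zeta\cdot\omega)^{\frac{2s-n}{2}}$ with $c > 0$, $\zeta \in \mathbb R^{n+1}$, $|\zeta| < 1$. For $h \in \mathcal M$ let $T_h\mathcal M$ be its tangent space at $h$, and let $(T_h\mathcal M)^\perp = \{\rho \in H^s(\mathbb S^n) : a_{2s}[\rho,\varphi] = 0 \text{ for all } \varphi \in T_h \mathcal M\}$. For $0 < u \in H^s(\mathbb S^n) \setminus \mathcal M$ define $$\mathsf d(u) = \inf\big\{ a_{2s}[\rho] : u = h + \rho,\ h \in \mathcal M,\ \rho \in (T_h\mathcal M)^\perp \big\}, \qquad \mathcal E(u) = \frac{a_{2s}[u] - \mathcal S_s \|u\|_{\frac{2n}{n-2s}}^2}{\mathsf d(u)},$$ and $$c_{BE}(s) = \inf_{0 < u \in H^s(\mathbb S^n)\setminus \mathcal M} \mathcal E(u).$$ Then $$c_{BE}(s) < \frac{4s}{n + 2s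 + 2}.$$ -/

import Mathlib

open MeasureTheory Metric

namespace ReverseSobolev

noncomputable section

/-- The unit sphere `𝕊ⁿ ⊂ ℝⁿ⁺¹`. -/
abbrev Sph (n : ℕ) : Type := sphere (0 : EuclideanSpace ℝ (Fin (n + 1))) 1

/-- The (non-normalized) surface measure on `𝕊ⁿ`, with total mass `|𝕊ⁿ|`. -/
abbrev surf (n : ℕ) : Measure (Sph n) :=
  (volume : Measure (EuclideanSpace ℝ (Fin (n + 1)))).toSphere

/-- The Hilbert space `L²(𝕊ⁿ)` of real functions. -/
abbrev L2 (n : ℕ) : Type := Lp ℝ 2 (surf n)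

/-- The class in `L²(𝕊ⁿ)` of a continuous function. -/
def toL2 (n : ℕ) : C(Sph n, ℝ) →L[ℝ] L2 n := ContinuousMap.toLp 2 (surf n) ℝ

/-! ### Spherical harmonics -/

/-- Real polynomials in `n + 1` variables that are homogeneous of degree `ℓ` and harmonic. -/
def solidHarmonics (n ℓ : ℕ) : Submodule ℝ (MvPolynomial (Fin (n + 1)) ℝ) :=
  MvPolynomial.homogeneousSubmodule (Fin (n + 1)) ℝ ℓ ⊓
    LinearMap.ker (∑ i : Fin (n + 1),
      (MvPolynomial.pderiv (R := ℝ) i).toLinearMap ∘ₗ (MvPolynomial.pderiv (R := ℝ) i).toLinearMap)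

theorem mem_solidHarmonics {n ℓ : ℕ} {P : MvPolynomial (Fin (n + 1)) ℝ} :
    P ∈ solidHarmonics n ℓ ↔ P.IsHomogeneous ℓ ∧
      ∑ i : Fin (n + 1), MvPolynomial.pderiv i (MvPolynomial.pderiv i P) = 0 := by
  simp [solidHarmonics, MvPolynomial.mem_homogeneousSubmodule, LinearMap.sum_apply]

/-- Restriction of a polynomial to the sphere. -/
def restrictSphere (n : ℕ) : MvPolynomial (Fin (n + 1)) ℝ →ₗ[ℝ] C(Sph n, ℝ) where
  toFun P := ⟨fun ω => MvPolynomial.eval (fun i => (ω : EuclideanSpace ℝ (Fin (n + 1))) i) P,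
    (MvPolynomial.continuous_eval P).comp (by fun_prop)⟩
  map_add' P Q := by ext ω; simp
  map_smul' a P := by ext ω; simp

/-- The space `E_ℓ ⊂ L²(𝕊ⁿ)` of spherical harmonics of degree `ℓ`. -/
def sphericalHarmonics (n ℓ : ℕ) : Submodule ℝ (L2 n) :=
  (solidHarmonics n ℓ).map ((toL2 n).toLinearMap ∘ₗ restrictSphere n)

instance finiteDimensional_homogeneous (n ℓ : ℕ) :
    FiniteDimensional ℝ (MvPolynomial.homogeneousSubmodule (Fin (n + 1)) ℝ ℓ) :=
  Module.Finite.iff_fg.mpr (MvPolynomial.homogeneousSubmodule_fg _ _ ℓ)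

instance finiteDimensional_sphericalHarmonics (n ℓ : ℕ) :
    FiniteDimensional ℝ (sphericalHarmonics n ℓ) := by
  have : FiniteDimensional ℝ (solidHarmonics n ℓ) :=
    Submodule.finiteDimensional_of_le (S₂ := MvPolynomial.homogeneousSubmodule (Fin (n + 1)) ℝ ℓ)
      inf_le_left
  unfold sphericalHarmonics
  infer_instance

/-- The `L²`-orthogonal projection `P_ℓ` onto the spherical harmonics of degree `ℓ`. -/
def proj (n ℓ : ℕ) : L2 n →L[ℝ] L2 n := (sphericalHarmonics n ℓ).starProjection

/-- `f ∈ Hˢ(𝕊ⁿ)`, in the spectral form: `-Δ` has the eigenvalue `ℓ (ℓ + n - 1)` on the spherical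
harmonics of degree `ℓ`. -/
def MemHs (n : ℕ) (s : ℝ) (f : L2 n) : Prop :=
  Summable fun ℓ : ℕ => (1 + (ℓ : ℝ) * (ℓ + n - 1)) ^ s * ‖proj n ℓ f‖ ^ 2

/-! ### The quadratic form and the optimizers -/

/-- The eigenvalue `α_{2s}(ℓ) = Γ(ℓ + n/2 + s) / Γ(ℓ + n/2 - s)`. -/
def alpha (n : ℕ) (s : ℝ) (ℓ : ℕ) : ℝ :=
  Real.Gamma (ℓ + n / 2 + s) / Real.Gamma (ℓ + n / 2 - s)

/-- The bilinear form `a_{2s}[f, g]`. -/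
def bilin (n : ℕ) (s : ℝ) (f g : L2 n) : ℝ :=
  ∑' ℓ : ℕ, alpha n s ℓ * inner ℝ (proj n ℓ f) (proj n ℓ g)

/-- The quadratic form `a_{2s}[f] = ∑ α_{2s}(ℓ) ‖P_ℓ f‖²`. -/
def quad (n : ℕ) (s : ℝ) (f : L2 n) : ℝ :=
  ∑' ℓ : ℕ, alpha n s ℓ * ‖proj n ℓ f‖ ^ 2

/-- The sharp constant `𝒮_s` of the reverse Sobolev inequality. -/
def sobolevConst (n : ℕ) (s : ℝ) : ℝ :=
  (4 * Real.pi) ^ s * (Real.Gamma ((n + 2 * s) / 2) / Real.Gamma ((n - 2 * s) / 2)) *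
    (Real.Gamma (n / 2) / Real.Gamma n) ^ (2 * s / n)

/-- `‖u‖_q = (∫ u^q)^{1/q}` for positive `u` and real `q ≠ 0`, possibly negative. -/
def powNorm (n : ℕ) (q : ℝ) (u : C(Sph n, ℝ)) : ℝ :=
  (∫ ω, u ω ^ q ∂(surf n)) ^ (1 / q)

/-- The manifold `ℳ` of the functions `ω ↦ c (1 - ζ · ω)^{(2s - n)/2}`, `c > 0`, `|ζ| < 1`. -/
def optimizers (n : ℕ) (s : ℝ) : Set C(Sph n, ℝ) :=
  {h | ∃ (c : ℝ) (ζ : EuclideanSpace ℝ (Fin (n + 1))), 0 < c ∧ ‖ζ‖ < 1 ∧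
    ∀ ω : Sph n, h ω =
      c * (1 - inner ℝ ζ (ω : EuclideanSpace ℝ (Fin (n + 1)))) ^ ((2 * s - n) / 2)}

/-- The tangent space `T_h ℳ`: the velocities at time `0` of the paths in `ℳ` that pass through
`h` at time `0`. -/
def tangentSpace (n : ℕ) (s : ℝ) (h : C(Sph n, ℝ)) : Set C(Sph n, ℝ) :=
  {φ | ∃ (ε : ℝ) (γ : ℝ → C(Sph n, ℝ)), 0 < ε ∧ (∀ t ∈ Set.Ioo (-ε) ε, γ t ∈ optimizers n s) ∧
    γ 0 = h ∧ ∀ ω : Sph n, HasDerivAt (fun t => γ t ω) (φ ω) 0}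

/-- The orthogonal complement `(T_h ℳ)^⊥` in `Hˢ(𝕊ⁿ)` with respect to `a_{2s}`. -/
def tangentPerp (n : ℕ) (s : ℝ) (h : C(Sph n, ℝ)) : Set (L2 n) :=
  {ρ | MemHs n s ρ ∧ ∀ φ ∈ tangentSpace n s h, bilin n s ρ (toL2 n φ) = 0}

/-! ### The stability quotient -/

/-- The modified distance `𝖽(u)`: the infimum of `a_{2s}[ρ]` over all decompositions `u = h + ρ`
with `h ∈ ℳ` and `ρ ∈ (T_h ℳ)^⊥`. -/
def stabDist (n : ℕ) (s : ℝ) (u : C(Sph n, ℝ)) : EReal :=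
  sInf {r : EReal | ∃ h ∈ optimizers n s, ∃ ρ ∈ tangentPerp n s h,
    toL2 n u = toL2 n h + ρ ∧ r = ((quad n s ρ : ℝ) : EReal)}

/-- The stability quotient `ℰ(u)`. -/
def quotient (n : ℕ) (s : ℝ) (u : C(Sph n, ℝ)) : EReal :=
  ((quad n s (toL2 n u) - sobolevConst n s * powNorm n (2 * n / (n - 2 * s)) u ^ 2 : ℝ) : EReal) /
    stabDist n s u

/-- The functions `0 < u ∈ Hˢ(𝕊ⁿ) \ ℳ`. For `s > n/2` every class in `Hˢ(𝕊ⁿ)` has exactly one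
continuous representative, and `u` is that representative. -/
def admissible (n : ℕ) (s : ℝ) : Set C(Sph n, ℝ) :=
  {u | MemHs n s (toL2 n u) ∧ (∀ ω, 0 < u ω) ∧ u ∉ optimizers n s}

/-- The stability constant `c_BE(s)`: the infimum of `ℰ(u)` over `0 < u ∈ Hˢ(𝕊ⁿ) \ ℳ`, taken in
the extended reals. -/
def cBE (n : ℕ) (s : ℝ) : EReal := sInf (quotient n s '' admissible n s)

end

end ReverseSobolev

/-!
Constants are optimizers, and at them the quotient `ℰ` in the direction of a spherical harmonic `Y`
of degree `ℓ ≥ 2` tends to `1 - α(1) / α(ℓ)`, which is `4s / (n + 2s + 2)` for `ℓ = 2`. The strict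
inequality comes from the third order: for `u = 1 - δ Y` with small `δ > 0` and `∫ Y³ > 0`, the
cubic term of `‖u‖²` pushes the quotient below this limit. For `Y = x_i x_j + x_j x_k + x_k x_i`,
which needs three coordinates, `∫ Y³ > 0` by symmetry.

The distance `𝖽(u)` is bounded below by `δ² α(2) ∫ Y²`, its value for the decomposition `h = 1`. As
`a_{2s}` has a single negative mode, the constants, this amounts to a reverse Cauchy–Schwarz
inequality between `u` and an arbitrary optimizer `h`, uniform in `h`.
-/

namespace ReverseSobolev

open Set Filter MvPolynomial
open scoped Topology

section Gaussian

variable {ι : Type*}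

theorem integrable_pow_mul_exp_neg_sq (k : ℕ) :
    Integrable fun x : ℝ => x ^ k * Real.exp (-x ^ 2) := by
  have hk : (-1 : ℝ) < k := by linarith [k.cast_nonneg (α := ℝ)]
  simpa [Real.rpow_natCast] using integrable_rpow_mul_exp_neg_mul_sq one_pos hk

theorem integral_Ioi_pow_mul_exp_neg_sq_pos (k : ℕ) :
    0 < ∫ r in Ioi (0 : ℝ), r ^ k * Real.exp (-r ^ 2) := by
  have hk : (-1 : ℝ) < k := by linarith [k.cast_nonneg (α := ℝ)]
  have h := integral_rpow_mul_exp_neg_rpow two_pos hk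
  simp only [Real.rpow_natCast, Real.rpow_ofNat] at h
  rw [h]
  positivity

theorem hasLineDerivAt_eval [DecidableEq ι] (P : MvPolynomial ι ℝ) (x : EuclideanSpace ℝ ι)
    (i : ι) : HasLineDerivAt ℝ (fun y : EuclideanSpace ℝ ι => eval y P) (eval x (pderiv i P)) x
      (EuclideanSpace.single i 1) := by
  induction P using MvPolynomial.induction_on with
  | C a => simpa [HasLineDerivAt] using hasDerivAt_const (0 : ℝ) a
  | add P Q hP hQ =>
    simp only [map_add]
    exact HasDerivAt.add hP hQ
  | mul_X P j hP =>
    have hX : HasDerivAt (fun t : ℝ => (x + t • EuclideanSpace.single i (1 : ℝ)) j)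
        ((EuclideanSpace.single i (1 : ℝ)) j) 0 := by
      simpa only [PiLp.add_apply, PiLp.smul_apply, smul_eq_mul, one_mul, id] using
        ((hasDerivAt_id (0 : ℝ)).mul_const (EuclideanSpace.single i (1 : ℝ) j)).const_add (x j)
    simp only [map_mul, eval_X]
    refine (HasDerivAt.mul hP hX).congr_deriv ?_
    simp only [zero_smul, add_zero, Derivation.leibniz, pderiv_X, smul_eq_mul, map_add, map_mul,
      eval_X, PiLp.single_apply, Pi.single_apply, apply_ite (eval _), map_one, map_zero]
    ring

variable [Fintype ι]

theorem integrable_eval_mul_exp_neg_norm_sq (P : MvPolynomial ι ℝ) :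
    Integrable fun x : EuclideanSpace ℝ ι => eval x P * Real.exp (-‖x‖ ^ 2) := by
  induction P using MvPolynomial.induction_on' with
  | monomial m a =>
    have hprod : ∀ x : EuclideanSpace ℝ ι, eval x (monomial m a) * Real.exp (-‖x‖ ^ 2) =
        a * ∏ i, (x i ^ m i * Real.exp (-x i ^ 2)) := fun x => by
      rw [eval_monomial, Finset.prod_mul_distrib, ← Real.exp_sum,
        EuclideanSpace.real_norm_sq_eq, Finset.sum_neg_distrib,
        Finsupp.prod_fintype _ _ (fun i => pow_zero _), mul_assoc]
    simp_rw [hprod]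
    have h : Integrable fun y : ι → ℝ => ∏ i, (y i ^ m i * Real.exp (-y i ^ 2)) :=
      Integrable.fintype_prod fun i => integrable_pow_mul_exp_neg_sq (m i)
    exact (((EuclideanSpace.volume_preserving_symm_measurableEquiv_toLp ι).integrable_comp_emb
      (MeasurableEquiv.measurableEmbedding _)).mpr h).const_mul a
  | add P Q hP hQ =>
    simp only [map_add, add_mul]
    exact hP.add hQ

/-- Integration of polynomials against the Gaussian weight `exp (-‖x‖²)`. -/
noncomputable def gaussIntegral (ι : Type*) [Fintype ι] : MvPolynomial ι ℝ →ₗ[ℝ] ℝ where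
  toFun P := ∫ x : EuclideanSpace ℝ ι, eval x P * Real.exp (-‖x‖ ^ 2)
  map_add' P Q := by
    simp only [map_add, add_mul]
    exact integral_add (integrable_eval_mul_exp_neg_norm_sq P)
      (integrable_eval_mul_exp_neg_norm_sq Q)
  map_smul' a P := by
    simp only [smul_eval, mul_assoc, RingHom.id_apply, smul_eq_mul]
    rw [integral_const_mul]

theorem hasLineDerivAt_exp_neg_norm_sq (x v : EuclideanSpace ℝ ι) :
    HasLineDerivAt ℝ (fun y : EuclideanSpace ℝ ι => Real.exp (-‖y‖ ^ 2))
      (-(2 * inner ℝ x v) * Real.exp (-‖x‖ ^ 2)) x v := by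
  have h : HasFDerivAt (fun y : EuclideanSpace ℝ ι => Real.exp (-‖y‖ ^ 2)) _ x :=
    ((hasStrictFDerivAt_norm_sq x).hasFDerivAt.neg).exp
  refine (h.hasLineDerivAt v).congr_deriv ?_
  simp only [Pi.neg_apply, smul_neg, neg_apply, smul_apply, coe_innerSL_apply, nsmul_eq_mul,
    Nat.cast_ofNat, smul_eq_mul, neg_mul, neg_inj]
  ring

theorem gaussIntegral_pderiv (i : ι) (P : MvPolynomial ι ℝ) :
    gaussIntegral ι (pderiv i P) = 2 * gaussIntegral ι (X i * P) := by
  classical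
  have hderiv : ∀ x : EuclideanSpace ℝ ι,
      eval x P * (-(2 * inner ℝ x (EuclideanSpace.single i 1)) * Real.exp (-‖x‖ ^ 2)) =
        -2 * (eval x (X i * P) * Real.exp (-‖x‖ ^ 2)) := fun x => by
    simp only [EuclideanSpace.inner_single_right, one_mul, map_mul, eval_X, conj_trivial]
    ring
  have hparts := integral_bilinear_hasLineDerivAt_right_eq_neg_left_of_integrable
    (μ := (volume : Measure (EuclideanSpace ℝ ι))) (B := ContinuousLinearMap.mul ℝ ℝ)
    (v := EuclideanSpace.single i 1)
    (integrable_eval_mul_exp_neg_norm_sq (pderiv i P))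
    (by simpa only [ContinuousLinearMap.mul_apply', hderiv] using
      (integrable_eval_mul_exp_neg_norm_sq (X i * P)).const_mul (-2))
    (integrable_eval_mul_exp_neg_norm_sq P)
    (fun x _ => hasLineDerivAt_eval P x i) fun x _ => hasLineDerivAt_exp_neg_norm_sq x _
  simp only [ContinuousLinearMap.mul_apply', hderiv, integral_const_mul] at hparts
  change ∫ x : EuclideanSpace ℝ ι, eval x (pderiv i P) * Real.exp (-‖x‖ ^ 2) =
    2 * ∫ x : EuclideanSpace ℝ ι, eval x (X i * P) * Real.exp (-‖x‖ ^ 2)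
  linarith

theorem two_mul_degree_mul_gaussIntegral {P Q : MvPolynomial ι ℝ} {l : ℕ} (hQ : Q.IsHomogeneous l)
    (hharm : ∑ i, pderiv i (pderiv i Q) = 0) :
    2 * (l * gaussIntegral ι (P * Q)) = gaussIntegral ι (∑ i, pderiv i P * pderiv i Q) := by
  have heuler : ∑ i, X i * (P * pderiv i Q) = (l : ℝ) • (P * Q) := by
    simp_rw [mul_left_comm _ P, ← Finset.mul_sum, hQ.sum_X_mul_pderiv]
    rw [mul_smul_comm, Nat.cast_smul_eq_nsmul]
  calc
    2 * (l * gaussIntegral ι (P * Q)) =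
        ∑ i, 2 * gaussIntegral ι (X i * (P * pderiv i Q)) := by
      rw [← smul_eq_mul (l : ℝ), ← map_smul, ← heuler, map_sum, Finset.mul_sum]
    _ = gaussIntegral ι (P * ∑ i, pderiv i (pderiv i Q)) +
        gaussIntegral ι (∑ i, pderiv i P * pderiv i Q) := by
      simp_rw [← gaussIntegral_pderiv, Derivation.leibniz, smul_eq_mul, map_add,
        mul_comm (pderiv _ Q)]
      rw [Finset.sum_add_distrib, Finset.mul_sum, map_sum, map_sum]
    _ = gaussIntegral ι (∑ i, pderiv i P * pderiv i Q) := by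
      rw [hharm, mul_zero, map_zero, zero_add]

theorem gaussIntegral_mul_eq_zero {P Q : MvPolynomial ι ℝ} {k l : ℕ} (hkl : k ≠ l)
    (hP : P.IsHomogeneous k) (hQ : Q.IsHomogeneous l)
    (hP' : ∑ i, pderiv i (pderiv i P) = 0) (hQ' : ∑ i, pderiv i (pderiv i Q) = 0) :
    gaussIntegral ι (P * Q) = 0 := by
  have hl := two_mul_degree_mul_gaussIntegral (P := P) hQ hQ'
  have hk := two_mul_degree_mul_gaussIntegral (P := Q) hP hP'
  simp_rw [mul_comm (pderiv _ Q)] at hk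
  rw [← hl, mul_comm Q P] at hk
  have hne : (k : ℝ) - l ≠ 0 := sub_ne_zero.mpr (mod_cast hkl)
  refine (mul_eq_zero.mp ?_).resolve_left hne
  linarith

end Gaussian

section Polar

variable {E : Type*} [NormedAddCommGroup E] [MeasurableSpace E] [BorelSpace E]

theorem integral_homogeneous_mul_radial [NormedSpace ℝ E] [FiniteDimensional ℝ E] [Nontrivial E]
    (μ : Measure E) [μ.IsAddHaarMeasure] {d : ℕ} {F : E → ℝ}
    (hF : ∀ (r : ℝ) (x : E), F (r • x) = r ^ d * F x) (g : ℝ → ℝ) :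
    ∫ x, F x * g ‖x‖ ∂μ = (∫ ω : sphere (0 : E) 1, F ω ∂μ.toSphere) *
      ∫ r in Ioi (0 : ℝ), r ^ (Module.finrank ℝ E - 1) * (r ^ d * g r) := by
  set m := Module.finrank ℝ E - 1
  have hpolar : ∀ x : ({(0)}ᶜ : Set E),
      F x.1 = F (‖x.1‖⁻¹ • x.1) * ‖x.1‖ ^ d := fun x => by
    rw [mul_comm, ← hF, smul_smul, mul_inv_cancel₀ (norm_ne_zero_iff.mpr x.2), one_smul]
  calc
    ∫ x, F x * g ‖x‖ ∂μ = ∫ x : ({(0)}ᶜ : Set E), F x.1 * g ‖x.1‖ ∂(μ.comap (↑)) := by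
      rw [integral_subtype_comap (measurableSet_singleton _).compl fun x ↦ F x * g ‖x‖,
        restrict_compl_singleton]
    _ = ∫ x, F x.1 * ((x.2 : ℝ) ^ d * g x.2) ∂μ.toSphere.prod (.volumeIoiPow m) := by
      rw [← μ.measurePreserving_homeomorphUnitSphereProd.integral_comp
        (Homeomorph.measurableEmbedding _)]
      refine integral_congr_ae (.of_forall fun x => ?_)
      simp only [homeomorphUnitSphereProd_apply_snd_coe, homeomorphUnitSphereProd_apply_fst_coe]
      rw [hpolar, mul_assoc]
    _ = (∫ ω : sphere (0 : E) 1, F ω ∂μ.toSphere) *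
        ∫ r : Ioi (0 : ℝ), (r : ℝ) ^ d * g r ∂.volumeIoiPow m :=
      integral_prod_mul (fun ω : sphere (0 : E) 1 => F ω) fun r : Ioi (0 : ℝ) => (r : ℝ) ^ d * g r
    _ = _ := by
      congr 1
      simp only [Measure.volumeIoiPow, ENNReal.ofReal]
      rw [integral_withDensity_eq_integral_smul,
        integral_subtype_comap measurableSet_Ioi fun a ↦ Real.toNNReal (a ^ m) • (a ^ d * g a),
        setIntegral_congr_fun measurableSet_Ioi fun x hx ↦ ?_]
      · simp only [NNReal.smul_def]
        rw [Real.coe_toNNReal _ (pow_nonneg hx.out.le _), smul_eq_mul]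
      · exact (measurable_subtype_coe.pow_const _).real_toNNReal

theorem exists_integral_homogeneous_mul_exp_eq [NormedSpace ℝ E] [FiniteDimensional ℝ E]
    [Nontrivial E] (μ : Measure E) [μ.IsAddHaarMeasure] (d : ℕ) : ∃ c : ℝ, c ≠ 0 ∧ ∀ F : E → ℝ,
      (∀ (r : ℝ) (x : E), F (r • x) = r ^ d * F x) →
        ∫ x, F x * Real.exp (-‖x‖ ^ 2) ∂μ = (∫ ω : sphere (0 : E) 1, F ω ∂μ.toSphere) * c := by
  refine ⟨_, ?_, fun F hF => integral_homogeneous_mul_radial μ hF fun r => Real.exp (-r ^ 2)⟩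
  simp_rw [← mul_assoc, ← pow_add]
  exact (integral_Ioi_pow_mul_exp_neg_sq_pos _).ne'

theorem integral_sphere_comp_linearIsometryEquiv [InnerProductSpace ℝ E]
    [FiniteDimensional ℝ E] [Nontrivial E] (L : E ≃ₗᵢ[ℝ] E) {d : ℕ} {F : E → ℝ}
    (hF : ∀ (r : ℝ) (x : E), F (r • x) = r ^ d * F x) :
    ∫ ω : sphere (0 : E) 1, F (L ω) ∂(volume : Measure E).toSphere =
      ∫ ω : sphere (0 : E) 1, F ω ∂(volume : Measure E).toSphere := by
  obtain ⟨c, hc, h⟩ := exists_integral_homogeneous_mul_exp_eq (volume : Measure E) d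
  refine mul_right_cancel₀ hc ?_
  have hcomp := L.measurePreserving.integral_comp L.toHomeomorph.measurableEmbedding
    fun x => F x * Real.exp (-‖x‖ ^ 2)
  simp_rw [L.norm_map] at hcomp
  rw [← h F hF, ← h (fun x => F (L x)) fun r x => by rw [map_smul, hF], hcomp]

end Polar

theorem eval_smul_of_isHomogeneous {ι R : Type*} [CommSemiring R] {d : ℕ}
    {P : MvPolynomial ι R} (hP : P.IsHomogeneous d) (r : R) (x : ι → R) :
    eval (r • x) P = r ^ d * eval x P := by
  simp only [eval_eq, Finset.mul_sum]
  refine Finset.sum_congr rfl fun m hm => ?_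
  have hd : ∑ i ∈ m.support, m i = d := by
    simp [← hP (mem_support_iff.mp hm), Finsupp.weight_apply, Finsupp.sum]
  simp only [Pi.smul_apply, smul_eq_mul, mul_pow, Finset.prod_mul_distrib,
    Finset.prod_pow_eq_pow_sum, hd]
  ring

theorem integrable_of_compactSpace {α : Type*} [TopologicalSpace α] [CompactSpace α]
    [MeasurableSpace α] [OpensMeasurableSpace α] {μ : Measure α} [IsFiniteMeasureOnCompacts μ]
    {f : α → ℝ} (hf : Continuous f) : Integrable f μ :=
  hf.integrable_of_hasCompactSupport (.of_compactSpace _)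

section SphericalHarmonics

variable {n k l : ℕ}

theorem restrictSphere_apply (P : MvPolynomial (Fin (n + 1)) ℝ) (ω : Sph n) :
    restrictSphere n P ω = eval (ω : EuclideanSpace ℝ (Fin (n + 1))) P := rfl

theorem inner_toL2 (f g : C(Sph n, ℝ)) :
    inner ℝ (toL2 n f) (toL2 n g) = ∫ ω, f ω * g ω ∂(surf n) := by
  rw [toL2, ContinuousMap.inner_toLp]
  simp only [conj_trivial, mul_comm]

theorem norm_toL2_sq (f : C(Sph n, ℝ)) : ‖toL2 n f‖ ^ 2 = ∫ ω, f ω ^ 2 ∂(surf n) := by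
  simp_rw [← real_inner_self_eq_norm_sq, inner_toL2, pow_two]

theorem norm_toL2_one_sq : ‖toL2 n 1‖ ^ 2 = (surf n).real univ := by
  simp [norm_toL2_sq]

theorem integral_restrictSphere_mul_eq_zero (hkl : k ≠ l) {P Q : MvPolynomial (Fin (n + 1)) ℝ}
    (hP : P ∈ solidHarmonics n k) (hQ : Q ∈ solidHarmonics n l) :
    ∫ ω, restrictSphere n P ω * restrictSphere n Q ω ∂(surf n) = 0 := by
  rw [mem_solidHarmonics] at hP hQ
  obtain ⟨c, hc, h⟩ := exists_integral_homogeneous_mul_exp_eq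
    (volume : Measure (EuclideanSpace ℝ (Fin (n + 1)))) (k + l)
  have hPQ := h (fun x => eval x (P * Q)) fun r x =>
    eval_smul_of_isHomogeneous (hP.1.mul hQ.1) r x
  have hgauss := gaussIntegral_mul_eq_zero hkl hP.1 hQ.1 hP.2 hQ.2
  have hsphere := (mul_eq_zero.mp (hPQ.symm.trans hgauss)).resolve_right hc
  simpa only [restrictSphere_apply, map_mul] using hsphere

theorem sphericalHarmonics_isOrtho (hkl : k ≠ l) :
    sphericalHarmonics n k ⟂ sphericalHarmonics n l := by
  rw [Submodule.isOrtho_iff_inner_eq]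
  rintro _ ⟨P, hP, rfl⟩ _ ⟨Q, hQ, rfl⟩
  exact (inner_toL2 _ _).trans (integral_restrictSphere_mul_eq_zero hkl hP hQ)

theorem proj_eq_self {f : L2 n} (hf : f ∈ sphericalHarmonics n l) : proj n l f = f :=
  Submodule.starProjection_eq_self_iff.mpr hf

theorem proj_eq_zero (hkl : k ≠ l) {f : L2 n} (hf : f ∈ sphericalHarmonics n l) :
    proj n k f = 0 :=
  (Submodule.starProjection_apply_eq_zero_iff _).mpr ((sphericalHarmonics_isOrtho hkl.symm) hf)

theorem inner_proj_left (f : L2 n) {g : L2 n} (hg : g ∈ sphericalHarmonics n l) :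
    inner ℝ (proj n l f) g = inner ℝ f g := by
  rw [proj, Submodule.inner_starProjection_left_eq_right, ← proj, proj_eq_self hg]

theorem toL2_restrictSphere_mem {P : MvPolynomial (Fin (n + 1)) ℝ} (hP : P ∈ solidHarmonics n l) :
    toL2 n (restrictSphere n P) ∈ sphericalHarmonics n l :=
  Submodule.mem_map_of_mem hP

theorem one_mem_solidHarmonics : (1 : MvPolynomial (Fin (n + 1)) ℝ) ∈ solidHarmonics n 0 :=
  mem_solidHarmonics.mpr ⟨isHomogeneous_one _ _, by simp⟩

theorem restrictSphere_one : restrictSphere n 1 = 1 := by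
  ext ω
  simp [restrictSphere_apply]

theorem toL2_one_mem : toL2 n 1 ∈ sphericalHarmonics n 0 :=
  restrictSphere_one (n := n) ▸ toL2_restrictSphere_mem one_mem_solidHarmonics

/-- The linear form `x ↦ ζ · x` as a polynomial. -/
noncomputable def linearForm (ζ : EuclideanSpace ℝ (Fin (n + 1))) :
    MvPolynomial (Fin (n + 1)) ℝ :=
  ∑ i, ζ i • X i

theorem linearForm_mem_solidHarmonics (ζ : EuclideanSpace ℝ (Fin (n + 1))) :
    linearForm ζ ∈ solidHarmonics n 1 := by
  refine Submodule.sum_mem _ fun i _ => Submodule.smul_mem _ _ ?_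
  rw [mem_solidHarmonics]
  refine ⟨isHomogeneous_X ℝ i, Finset.sum_eq_zero fun j _ => ?_⟩
  by_cases h : i = j <;> simp [pderiv_X, h]

theorem restrictSphere_linearForm (ζ : EuclideanSpace ℝ (Fin (n + 1))) (ω : Sph n) :
    restrictSphere n (linearForm ζ) ω = inner ℝ ζ (ω : EuclideanSpace ℝ (Fin (n + 1))) := by
  simp [restrictSphere_apply, linearForm, PiLp.inner_apply, mul_comm]

theorem integral_restrictSphere_eq_zero (hl : l ≠ 0) {P : MvPolynomial (Fin (n + 1)) ℝ}
    (hP : P ∈ solidHarmonics n l) : ∫ ω, restrictSphere n P ω ∂(surf n) = 0 := by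
  simpa [restrictSphere_one] using
    integral_restrictSphere_mul_eq_zero hl hP (one_mem_solidHarmonics (n := n))

theorem measureReal_surf_pos : 0 < (surf n).real univ := by
  have : NeZero (surf n) := ⟨Measure.toSphere_ne_zero _⟩
  exact measureReal_univ_pos

end SphericalHarmonics

section PairSum

variable {n : ℕ} {i j k : Fin (n + 1)}

/-- The quadratic polynomial `x_i x_j + x_j x_k + x_k x_i`, the harmonic of degree two that carries
the cubic term of the expansion. -/
noncomputable def pairSum (i j k : Fin (n + 1)) : MvPolynomial (Fin (n + 1)) ℝ :=
  X i * X j + X j * X k + X k * X i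

theorem X_mul_X_mem_solidHarmonics (hij : i ≠ j) :
    (X i * X j : MvPolynomial (Fin (n + 1)) ℝ) ∈ solidHarmonics n 2 := by
  rw [mem_solidHarmonics]
  refine ⟨(isHomogeneous_X ℝ i).mul (isHomogeneous_X ℝ j), Finset.sum_eq_zero fun l _ => ?_⟩
  simp only [Derivation.leibniz, pderiv_X, map_add, smul_eq_mul]
  rcases eq_or_ne i l with rfl | hil
  · simp [hij.symm]
  · rcases eq_or_ne j l with rfl | hjl <;> simp [*]

theorem pairSum_mem_solidHarmonics (hij : i ≠ j) (hjk : j ≠ k) (hki : k ≠ i) :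
    pairSum i j k ∈ solidHarmonics n 2 :=
  add_mem (add_mem (X_mul_X_mem_solidHarmonics hij) (X_mul_X_mem_solidHarmonics hjk))
    (X_mul_X_mem_solidHarmonics hki)

theorem integral_sphere_eval_neg_coord (l : Fin (n + 1)) {d : ℕ}
    {P : MvPolynomial (Fin (n + 1)) ℝ} (hP : P.IsHomogeneous d) :
    ∫ ω : Sph n, eval (fun m => if m = l then -ω.1 m else ω.1 m) P ∂(surf n) =
      ∫ ω, restrictSphere n P ω ∂(surf n) := by
  simp_rw [restrictSphere_apply]
  rw [← integral_sphere_comp_linearIsometryEquiv (LinearIsometryEquiv.piLpCongrRight 2 fun m =>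
      if m = l then LinearIsometryEquiv.neg ℝ else LinearIsometryEquiv.refl ℝ ℝ)
    (F := fun x : EuclideanSpace ℝ (Fin (n + 1)) => eval x P)
    fun r x => eval_smul_of_isHomogeneous hP r x]
  congr! 4 with ω
  funext m
  by_cases hm : m = l <;> simp [LinearIsometryEquiv.piLpCongrRight_apply, hm]

theorem integral_coord_mul_sq_pos (i j k : Fin (n + 1)) :
    0 < ∫ ω : Sph n, (ω.1 i * ω.1 j * ω.1 k) ^ 2 ∂(surf n) := by
  have hv : (WithLp.toLp 2 fun _ => 1 : EuclideanSpace ℝ (Fin (n + 1))) ≠ 0 := fun h => by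
    simpa using congrArg (fun v : EuclideanSpace ℝ (Fin (n + 1)) => v 0) h
  refine Continuous.integral_pos_of_hasCompactSupport_nonneg_nonzero (by fun_prop)
    (.of_compactSpace _) (fun ω => sq_nonneg _)
    (x := ⟨_, by simpa using norm_smul_inv_norm (𝕜 := ℝ) hv⟩) ?_
  simpa using hv

-- Averaging the cube over the sign changes of `x_i`, of `x_j` and of `x_k` leaves only the even
-- monomial `6 (x_i x_j x_k)²`.
theorem integral_pairSum_cube (hij : i ≠ j) (hjk : j ≠ k) (hki : k ≠ i) :
    ∫ ω, restrictSphere n (pairSum i j k) ω ^ 3 ∂(surf n) =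
      6 * ∫ ω : Sph n, (ω.1 i * ω.1 j * ω.1 k) ^ 2 ∂(surf n) := by
  have hhom := (mem_solidHarmonics.mp (pairSum_mem_solidHarmonics hij hjk hki)).1.pow 3
  have hint : ∀ g : Sph n → ℝ, Continuous g → Integrable g (surf n) := fun g hg =>
    integrable_of_compactSpace hg
  have hi := integral_sphere_eval_neg_coord i hhom
  have hj := integral_sphere_eval_neg_coord j hhom
  have hk := integral_sphere_eval_neg_coord k hhom
  simp only [restrictSphere_apply, map_pow] at hi hj hk ⊢
  simp only [pairSum, map_add, map_mul, eval_X, hij, hij.symm, hjk, hjk.symm, hki, hki.symm,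
    if_true, if_false] at hi hj hk ⊢
  have hcubes : ∀ ω : Sph n, 24 * (ω.1 i * ω.1 j * ω.1 k) ^ 2 =
      (ω.1 i * ω.1 j + ω.1 j * ω.1 k + ω.1 k * ω.1 i) ^ 3 +
      (-ω.1 i * ω.1 j + ω.1 j * ω.1 k + ω.1 k * -ω.1 i) ^ 3 +
      (ω.1 i * -ω.1 j + -ω.1 j * ω.1 k + ω.1 k * ω.1 i) ^ 3 +
      (ω.1 i * ω.1 j + ω.1 j * -ω.1 k + -ω.1 k * ω.1 i) ^ 3 := fun ω => by ring
  have hsum := integral_const_mul (μ := surf n) 24 fun ω => (ω.1 i * ω.1 j * ω.1 k) ^ 2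
  simp_rw [hcubes] at hsum
  rw [integral_add (hint _ (by fun_prop)) (hint _ (by fun_prop)),
    integral_add (hint _ (by fun_prop)) (hint _ (by fun_prop)),
    integral_add (hint _ (by fun_prop)) (hint _ (by fun_prop)), hi, hj, hk] at hsum
  linarith

theorem integral_pairSum_cube_pos (hij : i ≠ j) (hjk : j ≠ k) (hki : k ≠ i) :
    0 < ∫ ω, restrictSphere n (pairSum i j k) ω ^ 3 ∂(surf n) := by
  linarith [integral_pairSum_cube hij hjk hki, integral_coord_mul_sq_pos i j k]

end PairSum

section Alpha

variable {n : ℕ} {s : ℝ}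

theorem alpha_succ (hs : s - (n : ℝ) / 2 ∈ Ioo (0 : ℝ) 1) (ℓ : ℕ) :
    alpha n s (ℓ + 1) * (ℓ + n / 2 - s) = alpha n s ℓ * (ℓ + n / 2 + s) := by
  obtain ⟨h0, h1⟩ := hs
  have : (0 : ℝ) ≤ n := n.cast_nonneg
  have : (0 : ℝ) ≤ ℓ := ℓ.cast_nonneg
  have hsub : (ℓ : ℝ) + n / 2 - s ≠ 0 := by
    rcases ℓ.eq_zero_or_pos with rfl | h
    · simp only [Nat.cast_zero]
      linarith
    · have : (1 : ℝ) ≤ ℓ := mod_cast h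
      linarith
  simp only [alpha, Nat.cast_add, Nat.cast_one]
  rw [show (ℓ : ℝ) + 1 + n / 2 + s = (ℓ + n / 2 + s) + 1 by ring,
    show (ℓ : ℝ) + 1 + n / 2 - s = (ℓ + n / 2 - s) + 1 by ring,
    Real.Gamma_add_one hsub, Real.Gamma_add_one (by linarith), mul_div_mul_comm, mul_right_comm,
    div_mul_cancel₀ _ hsub, mul_comm]

theorem alpha_succ_pos (hs : s - (n : ℝ) / 2 ∈ Ioo (0 : ℝ) 1) (ℓ : ℕ) :
    0 < alpha n s (ℓ + 1) := by
  obtain ⟨h0, h1⟩ := hs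
  have : (0 : ℝ) ≤ n := n.cast_nonneg
  have : (0 : ℝ) ≤ ℓ := ℓ.cast_nonneg
  simp only [alpha, Nat.cast_add, Nat.cast_one]
  exact div_pos (Real.Gamma_pos_of_pos (by linarith)) (Real.Gamma_pos_of_pos (by linarith))

theorem alpha_pos (hs : s - (n : ℝ) / 2 ∈ Ioo (0 : ℝ) 1) {l : ℕ} (hl : l ≠ 0) :
    0 < alpha n s l := by
  obtain ⟨k, rfl⟩ := Nat.exists_eq_succ_of_ne_zero hl
  exact alpha_succ_pos hs k

theorem strictMono_alpha_succ (hs : s - (n : ℝ) / 2 ∈ Ioo (0 : ℝ) 1) :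
    StrictMono fun ℓ => alpha n s (ℓ + 1) := by
  refine strictMono_nat_of_lt_succ fun ℓ => ?_
  have hs0 : 0 < s := by linarith [hs.1, n.cast_nonneg (α := ℝ)]
  have hsub : 0 < ((ℓ + 1 : ℕ) : ℝ) + n / 2 - s := by
    push_cast
    linarith [hs.2, ℓ.cast_nonneg (α := ℝ)]
  refine lt_of_mul_lt_mul_right ?_ hsub.le
  rw [alpha_succ hs (ℓ + 1)]
  exact mul_lt_mul_of_pos_left (by linarith) (alpha_succ_pos hs ℓ)

theorem alpha_zero_neg (hs : s - (n : ℝ) / 2 ∈ Ioo (0 : ℝ) 1) : alpha n s 0 < 0 := by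
  have hpos : 0 < (n : ℝ) / 2 + s := by linarith [hs.1, n.cast_nonneg (α := ℝ)]
  have hsucc := alpha_succ hs 0
  have hneg := mul_neg_of_pos_of_neg (alpha_succ_pos hs 0) (sub_neg.mpr (sub_pos.mp hs.1))
  simp only [Nat.cast_zero, zero_add] at hsucc hneg
  exact neg_of_mul_neg_left (hsucc ▸ hneg) hpos.le

theorem Gamma_add_div_mul_rpow_antitone {a x : ℝ} (ha : 1 ≤ a) (hx : 0 < x) :
    Antitone fun k : ℕ => Real.Gamma (x + k + a) / Real.Gamma (x + k) / (x + k) ^ a := by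
  refine antitone_nat_of_succ_le fun k => ?_
  set y := x + k with hy
  have hy0 : 0 < y := by positivity
  have hbernoulli : 1 + a * y⁻¹ ≤ (1 + y⁻¹) ^ a :=
    one_add_mul_self_le_rpow_one_add (by linarith [inv_pos.mpr hy0]) ha
  have hsplit : (y + 1) ^ a = y ^ a * (1 + y⁻¹) ^ a := by
    rw [← Real.mul_rpow hy0.le (by positivity), mul_add, mul_inv_cancel₀ hy0.ne', mul_one]
  push_cast
  rw [show x + (k + 1) + a = (y + a) + 1 by rw [hy]; ring,
    show x + ((k : ℝ) + 1) = y + 1 by rw [hy]; ring, Real.Gamma_add_one (by positivity),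
    Real.Gamma_add_one hy0.ne', hsplit]
  calc
    (y + a) * Real.Gamma (y + a) / (y * Real.Gamma y) / (y ^ a * (1 + y⁻¹) ^ a) =
        Real.Gamma (y + a) / Real.Gamma y / y ^ a * ((1 + a * y⁻¹) / (1 + y⁻¹) ^ a) := by
      field_simp
    _ ≤ Real.Gamma (y + a) / Real.Gamma y / y ^ a := by
      refine mul_le_of_le_one_right (by positivity) ?_
      exact div_le_one_of_le₀ hbernoulli (by positivity)

theorem exists_alpha_succ_le (hn : 1 ≤ n) (hs : s - (n : ℝ) / 2 ∈ Ioo (0 : ℝ) 1) :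
    ∃ C, ∀ ℓ : ℕ, alpha n s (ℓ + 1) ≤ C * (1 + ((ℓ + 1 : ℕ) : ℝ) * ((ℓ + 1 : ℕ) + n - 1)) ^ s := by
  obtain ⟨h0, h1⟩ := hs
  have hn1 : (1 : ℝ) ≤ n := mod_cast hn
  set x : ℝ := 1 + n / 2 - s with hx
  have hx0 : 0 < x := by linarith
  refine ⟨Real.Gamma (x + 2 * s) / Real.Gamma x / x ^ (2 * s), fun ℓ => ?_⟩
  have : (0 : ℝ) ≤ ℓ := ℓ.cast_nonneg
  have hanti := Gamma_add_div_mul_rpow_antitone (show 1 ≤ 2 * s by linarith) hx0 ℓ.zero_le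
  have halpha : Real.Gamma (x + ℓ + 2 * s) / Real.Gamma (x + ℓ) = alpha n s (ℓ + 1) := by
    simp only [alpha, hx]
    congr 2 <;> push_cast <;> ring
  simp only [Nat.cast_zero, add_zero, halpha] at hanti
  refine ((div_le_iff₀ (by positivity)).mp hanti).trans ?_
  have hpow : (x + ℓ) ^ (2 * s) ≤ (1 + ((ℓ + 1 : ℕ) : ℝ) * ((ℓ + 1 : ℕ) + n - 1)) ^ s := by
    rw [Real.rpow_mul (by positivity), Real.rpow_two]
    refine Real.rpow_le_rpow (by positivity) ?_ (by linarith)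
    push_cast
    nlinarith
  have hGs := Real.Gamma_pos_of_pos (show 0 < x + 2 * s by linarith)
  gcongr

end Alpha

section Form

variable {n : ℕ} {s : ℝ} {f g h : L2 n}

theorem summable_alpha_mul_norm_sq (hn : 1 ≤ n) (hs : s - (n : ℝ) / 2 ∈ Ioo (0 : ℝ) 1)
    (hf : MemHs n s f) : Summable fun ℓ => alpha n s ℓ * ‖proj n ℓ f‖ ^ 2 := by
  obtain ⟨C, hC⟩ := exists_alpha_succ_le hn hs
  rw [← summable_nat_add_iff 1]
  refine Summable.of_nonneg_of_le (fun ℓ => mul_nonneg (alpha_succ_pos hs ℓ).le (sq_nonneg _))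
    (fun ℓ => ?_) (((summable_nat_add_iff 1).mpr hf).mul_left C)
  rw [← mul_assoc]
  exact mul_le_mul_of_nonneg_right (hC ℓ) (sq_nonneg _)

theorem summable_alpha_mul_inner (hn : 1 ≤ n) (hs : s - (n : ℝ) / 2 ∈ Ioo (0 : ℝ) 1)
    (hf : MemHs n s f) (hg : MemHs n s g) :
    Summable fun ℓ => alpha n s ℓ * inner ℝ (proj n ℓ f) (proj n ℓ g) := by
  refine Summable.of_norm_bounded ((summable_alpha_mul_norm_sq hn hs hf).norm.add
    (summable_alpha_mul_norm_sq hn hs hg).norm) fun ℓ => ?_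
  simp only [norm_mul, norm_pow, norm_norm, ← mul_add]
  refine mul_le_mul_of_nonneg_left ?_ (norm_nonneg _)
  nlinarith [norm_inner_le_norm (𝕜 := ℝ) (proj n ℓ f) (proj n ℓ g),
    sq_nonneg (‖proj n ℓ f‖ - ‖proj n ℓ g‖)]

theorem MemHs.sub (hf : MemHs n s f) (hg : MemHs n s g) : MemHs n s (f - g) := by
  have hweight : ∀ ℓ : ℕ, (0 : ℝ) ≤ (1 + (ℓ : ℝ) * (ℓ + n - 1)) ^ s := fun ℓ => by
    refine Real.rpow_nonneg ?_ _
    rcases ℓ.eq_zero_or_pos with rfl | hl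
    · simp
    · have : (1 : ℝ) ≤ ℓ := mod_cast hl
      nlinarith [n.cast_nonneg (α := ℝ)]
  refine Summable.of_nonneg_of_le (fun ℓ => mul_nonneg (hweight ℓ) (sq_nonneg _)) (fun ℓ => ?_)
    ((Summable.add hf hg).mul_left 2)
  rw [← mul_add, mul_left_comm, map_sub]
  refine mul_le_mul_of_nonneg_left ?_ (hweight ℓ)
  linarith [parallelogram_law_with_norm ℝ (proj n ℓ f) (proj n ℓ g),
    mul_self_nonneg ‖proj n ℓ f + proj n ℓ g‖]

theorem memHs_of_mem_sphericalHarmonics {l : ℕ} (hf : f ∈ sphericalHarmonics n l) :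
    MemHs n s f := by
  refine summable_of_hasFiniteSupport ((finite_singleton l).subset fun k hk => ?_)
  by_contra hkl
  exact hk (by simp [proj_eq_zero hkl hf])

theorem bilin_comm : bilin n s f g = bilin n s g f :=
  tsum_congr fun ℓ => by rw [real_inner_comm]

theorem bilin_self : bilin n s f f = quad n s f := by
  simp only [bilin, quad, real_inner_self_eq_norm_sq]

theorem bilin_sub_right (hn : 1 ≤ n) (hs : s - (n : ℝ) / 2 ∈ Ioo (0 : ℝ) 1) (hf : MemHs n s f)
    (hg : MemHs n s g) (hh : MemHs n s h) :
    bilin n s f (g - h) = bilin n s f g - bilin n s f h := by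
  simp only [bilin, map_sub, inner_sub_right, mul_sub]
  exact (summable_alpha_mul_inner hn hs hf hg).tsum_sub (summable_alpha_mul_inner hn hs hf hh)

theorem bilin_of_mem_sphericalHarmonics {l : ℕ} (hg : g ∈ sphericalHarmonics n l) :
    bilin n s f g = alpha n s l * inner ℝ f g := by
  rw [bilin, tsum_eq_single l fun k hk => by rw [proj_eq_zero hk hg, inner_zero_right, mul_zero],
    proj_eq_self hg, inner_proj_left f hg]

theorem alpha_zero_add_alpha_one_le_quad (hn : 1 ≤ n) (hs : s - (n : ℝ) / 2 ∈ Ioo (0 : ℝ) 1)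
    (hf : MemHs n s f) :
    alpha n s 0 * ‖proj n 0 f‖ ^ 2 + alpha n s 1 * ‖proj n 1 f‖ ^ 2 ≤ quad n s f := by
  have hsum := (summable_alpha_mul_norm_sq hn hs hf).sum_le_tsum (Finset.range 2) fun ℓ hℓ => by
    obtain ⟨m, rfl⟩ := Nat.exists_eq_succ_of_ne_zero (n := ℓ) (by rintro rfl; simp at hℓ)
    exact mul_nonneg (alpha_succ_pos hs m).le (sq_nonneg _)
  simpa [Finset.sum_range_succ, quad] using hsum

theorem sphericalHarmonics_zero : sphericalHarmonics n 0 = Submodule.span ℝ {toL2 n 1} := by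
  refine le_antisymm ?_ (Submodule.span_le.mpr (singleton_subset_iff.mpr toL2_one_mem))
  rintro _ ⟨P, hP, rfl⟩
  have hdeg := Nat.le_zero.mp (mem_solidHarmonics.mp hP).1.totalDegree_le
  rw [totalDegree_eq_zero_iff_eq_C, ← mul_one (C _), ← smul_eq_C_mul] at hdeg
  rw [hdeg, map_smul, LinearMap.comp_apply, restrictSphere_one]
  exact Submodule.smul_mem _ _ (Submodule.mem_span_singleton_self _)

theorem norm_proj_zero_sq_mul (f : L2 n) :
    ‖proj n 0 f‖ ^ 2 * (surf n).real univ = inner ℝ f (toL2 n 1) ^ 2 := by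
  have hV0 := (measureReal_surf_pos (n := n)).ne'
  have hproj : proj n 0 f = (inner ℝ (toL2 n 1) f / (surf n).real univ) • toL2 n 1 := by
    simp only [proj, sphericalHarmonics_zero, Submodule.starProjection_singleton,
      ← norm_toL2_one_sq, RCLike.ofReal_real_eq_id, id]
  rw [hproj, norm_smul, mul_pow, norm_toL2_one_sq, Real.norm_eq_abs, sq_abs, real_inner_comm,
    div_pow, sq (Measure.real _ _), ← div_div, div_mul_cancel₀ _ hV0, div_mul_cancel₀ _ hV0]

theorem inner_sq_le_norm_proj_sq_mul {l : ℕ} (f : L2 n) (hg : g ∈ sphericalHarmonics n l) :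
    inner ℝ f g ^ 2 ≤ ‖proj n l f‖ ^ 2 * ‖g‖ ^ 2 := by
  rw [← inner_proj_left f hg, ← mul_pow, ← sq_abs]
  exact pow_le_pow_left₀ (abs_nonneg _) (abs_real_inner_le_norm _ _) 2

end Form

section Rpow

variable {p x : ℝ}

theorem exists_rpow_one_add_eq_sum (p : ℝ) (n : ℕ) (hx : -1 < x) :
    ∃ y > 0, (1 + x) ^ p =
      ∑ k ∈ Finset.range (n + 1), (descPochhammer ℝ k).eval p / k.factorial * x ^ k +
        (descPochhammer ℝ (n + 1)).eval p / (n + 1).factorial * y ^ (p - (n + 1)) *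
          x ^ (n + 1) := by
  rcases eq_or_ne x 0 with rfl | hx0
  · exact ⟨1, one_pos, by simp [Finset.sum_range_succ']⟩
  have hpos : ∀ y ∈ uIcc 1 (1 + x), 0 < y := fun y hy =>
    (lt_inf_iff.mpr ⟨one_pos, by linarith⟩).trans_le hy.1
  have hsmooth (m : ℕ) {y : ℝ} (hy : y ∈ uIcc 1 (1 + x)) :
      ContDiffAt ℝ m (fun y : ℝ => y ^ p) y :=
    Real.contDiffAt_rpow_const_of_ne (hpos y hy).ne'
  have hderiv (m : ℕ) (y : ℝ) :
      iteratedDeriv m (fun y : ℝ => y ^ p) y = (descPochhammer ℝ m).eval p * y ^ (p - m) := by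
    rw [iteratedDeriv_eq_iterate, Real.iter_deriv_rpow_const]
  obtain ⟨y, hy, hTaylor⟩ := taylor_mean_remainder_lagrange_iteratedDeriv (x := 1 + x) (x₀ := 1)
    (n := n) (by simpa using hx0)
    (fun y hy => (hsmooth (n + 1) hy).contDiffWithinAt)
  refine ⟨y, hpos y (uIoo_subset_uIcc_self hy), ?_⟩
  have hunique : UniqueDiffOn ℝ (uIcc 1 (1 + x)) := uniqueDiffOn_Icc (by simpa using hx0)
  have hcoeff (m : ℕ) : iteratedDerivWithin m (fun y : ℝ => y ^ p) (uIcc 1 (1 + x)) 1 =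
      (descPochhammer ℝ m).eval p := by
    rw [iteratedDerivWithin_eq_iteratedDeriv hunique (hsmooth m left_mem_uIcc) left_mem_uIcc,
      hderiv, Real.one_rpow, mul_one]
  rw [sub_eq_iff_eq_add', taylor_within_apply, hderiv] at hTaylor
  simp only [hcoeff, add_sub_cancel_left, smul_eq_mul] at hTaylor
  rw [hTaylor]
  congr 1
  · exact Finset.sum_congr rfl fun k _ => by ring
  · push_cast
    ring

theorem one_add_mul_le_rpow_one_add_of_nonpos (hp : p ≤ 0) (hx : -1 < x) :
    1 + p * x ≤ (1 + x) ^ p := by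
  obtain ⟨y, hy, h⟩ := exists_rpow_one_add_eq_sum p 1 hx
  have hTaylor : (1 + x) ^ p = 1 + p * x + p * (p - 1) / 2 * y ^ (p - (1 + 1)) * x ^ 2 := by
    simpa [Finset.sum_range_succ, descPochhammer_succ_eval] using h
  have hcoeff : 0 ≤ p * (p - 1) := mul_nonneg_of_nonpos_of_nonpos hp (by linarith)
  rw [hTaylor]
  exact le_add_of_nonneg_right (by positivity)

theorem cubic_le_rpow_one_add (hp : p ≤ 0) (hx : -1 < x) :
    1 + p * x + p * (p - 1) / 2 * x ^ 2 + p * (p - 1) * (p - 2) / 6 * x ^ 3 ≤ (1 + x) ^ p := by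
  obtain ⟨y, hy, h⟩ := exists_rpow_one_add_eq_sum p 3 hx
  have hTaylor : (1 + x) ^ p =
      1 + p * x + p * (p - 1) / 2 * x ^ 2 + p * (p - 1) * (p - 2) / 6 * x ^ 3 +
        p * (p - 1) * (p - 2) * (p - 3) / 24 * y ^ (p - (3 + 1)) * x ^ 4 := by
    simpa [Finset.sum_range_succ, descPochhammer_succ_eval, Nat.factorial] using h
  have hcoeff : 0 ≤ p * (p - 1) * (p - 2) * (p - 3) := by
    rw [mul_assoc]
    exact mul_nonneg (mul_nonneg_of_nonpos_of_nonpos hp (by linarith))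
      (mul_nonneg_of_nonpos_of_nonpos (by linarith) (by linarith))
  rw [hTaylor]
  exact le_add_of_nonneg_right (by positivity)

theorem one_add_mul_div_le_rpow_one_add (hp : 0 ≤ p) (hx : -1 < x) :
    1 + p * (x / (1 + x)) ≤ (1 + x) ^ p := by
  have hx1 : 0 < 1 + x := by linarith
  have hinv : -1 < -(x / (1 + x)) := by
    rw [neg_lt_neg_iff, div_lt_one hx1]
    linarith
  have h := one_add_mul_le_rpow_one_add_of_nonpos (neg_nonpos.mpr hp) hinv
  have hbase : 1 + -(x / (1 + x)) = (1 + x)⁻¹ := by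
    field_simp
    ring
  rwa [hbase, neg_mul_neg, ← Real.rpow_neg_eq_inv_rpow, neg_neg] at h

theorem rpow_one_add_le_one_add_mul_div (hp0 : -1 ≤ p) (hp1 : p ≤ 0) (hx : -1 < x) :
    (1 + x) ^ p ≤ 1 + p * (x / (1 + x)) := by
  have hpos : 0 < 1 + x := by linarith
  have h := rpow_one_add_le_one_add_mul_self hx.le (p := p + 1) (by linarith) (by linarith)
  rw [Real.rpow_add_one hpos.ne', ← le_div_iff₀ hpos] at h
  refine h.trans_eq ?_
  field_simp
  ring

theorem one_sub_rpow_le (hp0 : 0 ≤ p) (hp1 : p ≤ 1) (hx : x ≤ 1) : (1 - x) ^ p ≤ 1 - p * x := by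
  have h := rpow_one_add_le_one_add_mul_self (s := -x) (by linarith) hp0 hp1
  rwa [mul_neg, ← sub_eq_add_neg, ← sub_eq_add_neg] at h

theorem le_one_sub_rpow (hp : p ≤ 1) (hx : x < 1) :
    1 - p * x - (1 - p) * x ^ 2 ≤ (1 - x) ^ p := by
  have hpos : 0 < 1 - x := by linarith
  have h := one_add_mul_le_rpow_one_add_of_nonpos (p := p - 1) (x := -x) (by linarith)
    (by linarith)
  rw [← sub_eq_add_neg, Real.rpow_sub_one hpos.ne', le_div_iff₀ hpos] at h
  exact (by ring : 1 - p * x - (1 - p) * x ^ 2 = (1 + (p - 1) * -x) * (1 - x)).trans_le h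

theorem abs_one_sub_rpow_sub_le (hp0 : 0 ≤ p) (hp1 : p ≤ 1) (hx : x < 1) :
    |(1 - x) ^ p - (1 - p * x)| ≤ x ^ 2 := by
  rw [abs_le]
  constructor <;> nlinarith [one_sub_rpow_le hp0 hp1 hx.le, le_one_sub_rpow hp1 hx, sq_nonneg x]

theorem one_sub_rpow_mul_le (hp0 : 0 ≤ p) (hp1 : p ≤ 1) (hx : |x| < 1) :
    (1 - x) ^ p * x ≤ x - p / 2 * x ^ 2 := by
  obtain ⟨hx1, hx2⟩ := abs_lt.mp hx
  rcases le_total 0 x with h | h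
  · nlinarith [one_sub_rpow_le hp0 hp1 hx2.le]
  · have hbound := one_add_mul_div_le_rpow_one_add hp0 (x := -x) (by linarith)
    have hhalf : -x / 2 ≤ -x / (1 + -x) :=
      div_le_div_of_nonneg_left (by linarith) (by linarith) (by linarith)
    rw [← sub_eq_add_neg] at hbound hhalf
    nlinarith [mul_le_mul_of_nonneg_left hhalf hp0]

theorem eventually_rpow_one_add_lt {b c : ℝ} (hp0 : -1 ≤ p) (hp1 : p < 0) (hb : 0 ≤ b)
    (hc : 0 < c) :
    ∀ᶠ δ in 𝓝[>] (0 : ℝ), (1 + (b * δ ^ 2 + c * δ ^ 3)) ^ p < 1 + p * (b * δ ^ 2) := by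
  have hsmall : ∀ᶠ δ in 𝓝[>] (0 : ℝ), b * δ * (b + c * δ) < c := by
    refine (Continuous.tendsto' (by fun_prop) 0 0 (by simp)).mono_left nhdsWithin_le_nhds
      |>.eventually_lt_const hc
  filter_upwards [hsmall, self_mem_nhdsWithin] with δ hδ (hδ0 : 0 < δ)
  have ha : 0 ≤ b * δ ^ 2 + c * δ ^ 3 := by positivity
  refine (rpow_one_add_le_one_add_mul_div hp0 hp1.le (by linarith)).trans_lt ?_
  rw [add_lt_add_iff_left, mul_lt_mul_left_of_neg hp1, lt_div_iff₀ (by linarith)]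
  nlinarith [mul_lt_mul_of_pos_left hδ (sq_pos_of_pos hδ0)]

end Rpow

section Profile

variable {α : Type*} [TopologicalSpace α] [CompactSpace α] [MeasurableSpace α]
  [OpensMeasurableSpace α] {μ : Measure α} [IsFiniteMeasure μ] {x φ : C(α, ℝ)} {p : ℝ}

theorem integrable_one_sub_rpow_mul (hp : 0 ≤ p) (x f : C(α, ℝ)) :
    Integrable (fun ω => (1 - x ω) ^ p * f ω) μ :=
  integrable_of_compactSpace <|
    (Continuous.rpow_const (by fun_prop) fun _ => Or.inr hp).mul f.continuous

theorem integral_one_sub_mul (hx0 : ∫ ω, x ω ∂μ = 0) : ∫ ω, (1 - p * x ω) ∂μ = μ.real univ := by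
  rw [integral_sub (integrable_const 1) (integrable_of_compactSpace (by fun_prop)),
    integral_const_mul, hx0]
  simp

theorem mul_measureReal_le_integral_one_sub_rpow (hp0 : 0 ≤ p) (hp1 : p ≤ 1)
    (hx : ∀ ω, |x ω| < 1) (hx0 : ∫ ω, x ω ∂μ = 0) :
    p * μ.real univ ≤ ∫ ω, (1 - x ω) ^ p ∂μ := by
  rw [← integral_one_sub_mul (p := 1) hx0, ← integral_const_mul]
  refine integral_mono (integrable_of_compactSpace (by fun_prop))
    (by simpa using integrable_one_sub_rpow_mul hp0 x 1) fun ω => ?_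
  have hsq : x ω ^ 2 ≤ 1 := (sq_le_one_iff_abs_le_one _).mpr (hx ω).le
  dsimp only
  nlinarith [le_one_sub_rpow hp1 (abs_lt.mp (hx ω)).2]

theorem integral_one_sub_rpow_le (hp0 : 0 ≤ p) (hp1 : p ≤ 1) (hx : ∀ ω, x ω ≤ 1)
    (hx0 : ∫ ω, x ω ∂μ = 0) : ∫ ω, (1 - x ω) ^ p ∂μ ≤ μ.real univ := by
  rw [← integral_one_sub_mul (p := p) hx0]
  exact integral_mono (by simpa using integrable_one_sub_rpow_mul hp0 x 1)
    (integrable_of_compactSpace (by fun_prop)) fun ω => one_sub_rpow_le hp0 hp1 (hx ω)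

theorem integral_one_sub_rpow_mul_self_le (hp0 : 0 ≤ p) (hp1 : p ≤ 1) (hx : ∀ ω, |x ω| < 1)
    (hx0 : ∫ ω, x ω ∂μ = 0) :
    ∫ ω, (1 - x ω) ^ p * x ω ∂μ ≤ -(p / 2 * ∫ ω, x ω ^ 2 ∂μ) := by
  have hsq : Integrable (fun ω => p / 2 * x ω ^ 2) μ := integrable_of_compactSpace (by fun_prop)
  have hlin : Integrable x μ := integrable_of_compactSpace (by fun_prop)
  calc
    _ ≤ ∫ ω, (x ω - p / 2 * x ω ^ 2) ∂μ :=
      integral_mono (integrable_one_sub_rpow_mul hp0 x x) (hlin.sub hsq)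
        fun ω => one_sub_rpow_mul_le hp0 hp1 (hx ω)
    _ = _ := by rw [integral_sub hlin hsq, hx0, integral_const_mul, zero_sub]

theorem abs_integral_one_sub_rpow_mul_le (hp0 : 0 ≤ p) (hp1 : p ≤ 1) (hx : ∀ ω, x ω < 1)
    (hφ0 : ∫ ω, φ ω ∂μ = 0) (hxφ : ∫ ω, x ω * φ ω ∂μ = 0) :
    |∫ ω, (1 - x ω) ^ p * φ ω ∂μ| ≤ ‖φ‖ * ∫ ω, x ω ^ 2 ∂μ := by
  have hlin : ∫ ω, (1 - p * x ω) * φ ω ∂μ = 0 := by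
    simp only [sub_mul, one_mul, mul_assoc]
    rw [integral_sub (integrable_of_compactSpace (by fun_prop))
      (integrable_of_compactSpace (by fun_prop)), integral_const_mul, hφ0, hxφ, mul_zero, sub_zero]
  have hremainder :
      ∫ ω, (1 - x ω) ^ p * φ ω ∂μ = ∫ ω, ((1 - x ω) ^ p - (1 - p * x ω)) * φ ω ∂μ := by
    simp only [sub_mul _ (1 - p * _)]
    have hint : Integrable (fun ω => (1 - p * x ω) * φ ω) μ :=
      integrable_of_compactSpace (by fun_prop)
    rw [integral_sub (integrable_one_sub_rpow_mul hp0 x φ) hint, hlin, sub_zero]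
  rw [hremainder, ← integral_const_mul, ← Real.norm_eq_abs]
  have hsq : Integrable (fun ω => ‖φ‖ * x ω ^ 2) μ := integrable_of_compactSpace (by fun_prop)
  refine norm_integral_le_of_norm_le hsq (.of_forall fun ω => ?_)
  rw [norm_mul, mul_comm]
  exact mul_le_mul (φ.norm_coe_le_norm ω) (abs_one_sub_rpow_sub_le hp0 hp1 (hx ω))
    (norm_nonneg _) (norm_nonneg _)

end Profile

section Distance

variable {n l : ℕ} {s : ℝ} {h u : C(Sph n, ℝ)} {P : MvPolynomial (Fin (n + 1)) ℝ}

theorem mem_tangentSpace_self (hh : h ∈ optimizers n s) : h ∈ tangentSpace n s h := by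
  obtain ⟨c, ζ, hc, hζ, hω⟩ := hh
  refine ⟨1, fun t => (1 + t) • h, one_pos, fun t ht => ⟨(1 + t) * c, ζ, ?_, hζ, fun ω => ?_⟩,
    by simp, fun ω => ?_⟩
  · exact mul_pos (by linarith [ht.1]) hc
  · simp [hω ω, mul_assoc]
  · simpa using ((hasDerivAt_id (0 : ℝ)).const_add 1).mul_const (h ω)

theorem stabDist_nonpos_of_mem_optimizers (hu : u ∈ optimizers n s) : stabDist n s u ≤ 0 := by
  refine sInf_le ⟨u, hu, 0, ⟨?_, fun φ _ => ?_⟩, (add_zero _).symm, ?_⟩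
  · simp [MemHs]
  · simp [bilin]
  · simp [quad]

-- If `u = h + ρ` with `a[ρ, h] = 0`, then `a[h] = a[h, u]`, so `a[ρ] = a[u] - a[h]`, and dividing
-- `m a[h] ≤ a[h, u]²` by `a[h, u] < 0` turns it into `a[h] ≤ m`.
theorem coe_quad_sub_le_stabDist (hn : 1 ≤ n) (hs : s - (n : ℝ) / 2 ∈ Ioo (0 : ℝ) 1)
    (hu : MemHs n s (toL2 n u)) {m : ℝ}
    (hopt : ∀ h ∈ optimizers n s, MemHs n s (toL2 n h) →
      bilin n s (toL2 n h) (toL2 n u) < 0 ∧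
        m * quad n s (toL2 n h) ≤ bilin n s (toL2 n h) (toL2 n u) ^ 2) :
    ((quad n s (toL2 n u) - m : ℝ) : EReal) ≤ stabDist n s u := by
  refine le_sInf ?_
  rintro _ ⟨h, hh, ρ, ⟨hρ, horth⟩, hdecomp, rfl⟩
  have hρu : ρ = toL2 n u - toL2 n h := (sub_eq_of_eq_add' hdecomp).symm
  have hhu : toL2 n h = toL2 n u - ρ := eq_sub_of_add_eq hdecomp.symm
  have hh' : MemHs n s (toL2 n h) := hhu ▸ hu.sub hρ
  have hρh : bilin n s ρ (toL2 n h) = 0 := horth h (mem_tangentSpace_self hh)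
  have hquad : quad n s (toL2 n h) = bilin n s (toL2 n h) (toL2 n u) := by
    rw [bilin_comm, hρu, bilin_sub_right hn hs hh' hu hh', bilin_self] at hρh
    linarith
  have hquadρ : quad n s ρ = quad n s (toL2 n u) - quad n s (toL2 n h) := calc
    quad n s ρ = bilin n s ρ (toL2 n u - toL2 n h) := by rw [← hρu, bilin_self]
    _ = bilin n s (toL2 n u) (toL2 n u - toL2 n h) := by
      rw [bilin_sub_right hn hs hρ hu hh', hρh, sub_zero, bilin_comm, hρu]
    _ = quad n s (toL2 n u) - quad n s (toL2 n h) := by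
      rw [bilin_sub_right hn hs hu hu hh', bilin_self, hquad, bilin_comm]
  obtain ⟨hneg, hreverse⟩ := hopt h hh hh'
  rw [EReal.coe_le_coe_iff, hquadρ, sub_le_sub_iff_left]
  rw [hquad, sq] at hreverse
  exact hquad ▸ (mul_le_mul_right_of_neg hneg).mp hreverse

theorem exists_optimizer_eq (hh : h ∈ optimizers n s) :
    ∃ c > 0, ∃ P ∈ solidHarmonics n 1, (∀ ω, |restrictSphere n P ω| < 1) ∧
      ∀ ω, h ω = c * (1 - restrictSphere n P ω) ^ (s - (n : ℝ) / 2) := by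
  obtain ⟨c, ζ, hc, hζ, hω⟩ := hh
  refine ⟨c, hc, linearForm ζ, linearForm_mem_solidHarmonics ζ, fun ω => ?_, fun ω => ?_⟩
  · rw [restrictSphere_linearForm]
    have hbound := abs_real_inner_le_norm ζ ω.1
    rw [norm_eq_of_mem_sphere ω, mul_one] at hbound
    exact hbound.trans_lt hζ
  · rw [hω, restrictSphere_linearForm, show (2 * s - n) / 2 = s - (n : ℝ) / 2 by ring]

theorem sq_mul_norm_sq_le_norm_proj_sq {f g : L2 n} (hg : g ∈ sphericalHarmonics n l) {a : ℝ}
    (ha : 0 ≤ a) (hf : a * ‖g‖ ^ 2 ≤ |inner ℝ f g|) :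
    a ^ 2 * ‖g‖ ^ 2 ≤ ‖proj n l f‖ ^ 2 := by
  rcases (sq_nonneg ‖g‖).eq_or_lt' with hg0 | hg0
  · rw [hg0, mul_zero]
    positivity
  · refine le_of_mul_le_mul_right ?_ hg0
    calc
      a ^ 2 * ‖g‖ ^ 2 * ‖g‖ ^ 2 = (a * ‖g‖ ^ 2) ^ 2 := by ring
      _ ≤ |inner ℝ f g| ^ 2 := by gcongr
      _ ≤ ‖proj n l f‖ ^ 2 * ‖g‖ ^ 2 := (sq_abs _).trans_le (inner_sq_le_norm_proj_sq_mul f hg)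

-- The witness is `Q = ∫ (ζ·ω)²`; bounding both the degree-one part from below and the higher
-- degrees from above by the same `Q` is what makes the comparison uniform in `ζ`.
theorem exists_integral_optimizer_bounds (hs : s - (n : ℝ) / 2 ∈ Ioo (0 : ℝ) 1)
    (hh : h ∈ optimizers n s) :
    ∃ c > 0, ∃ Q ∈ Icc 0 ((surf n).real univ),
      ∫ ω, h ω ∂(surf n) ∈
        Icc (c * ((s - n / 2) * (surf n).real univ)) (c * (surf n).real univ) ∧
      (c * ((s - n / 2) / 2)) ^ 2 * Q ≤ ‖proj n 1 (toL2 n h)‖ ^ 2 ∧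
      ∀ {l : ℕ} {P : MvPolynomial (Fin (n + 1)) ℝ}, 2 ≤ l → P ∈ solidHarmonics n l →
        |∫ ω, h ω * restrictSphere n P ω ∂(surf n)| ≤ c * (‖restrictSphere n P‖ * Q) := by
  obtain ⟨c, hc, L, hL, hx, hh⟩ := exists_optimizer_eq hh
  have hx0 := integral_restrictSphere_eq_zero one_ne_zero hL
  have hp0 := hs.1.le
  have hp1 := hs.2.le
  simp only [hh, mul_assoc, integral_const_mul, abs_mul, abs_of_pos hc]
  refine ⟨c, hc, ∫ ω, restrictSphere n L ω ^ 2 ∂(surf n),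
    ⟨integral_nonneg fun ω => sq_nonneg _, ?_⟩, ⟨?_, ?_⟩, ?_, ?_⟩
  · simpa using integral_mono
      (integrable_of_compactSpace ((restrictSphere n L).continuous.pow 2))
      (integrable_const (μ := surf n) (1 : ℝ))
      fun ω => (sq_le_one_iff_abs_le_one _).mpr (hx ω).le
  · exact mul_le_mul_of_nonneg_left
      (mul_measureReal_le_integral_one_sub_rpow hp0 hp1 hx hx0) hc.le
  · exact mul_le_mul_of_nonneg_left
      (integral_one_sub_rpow_le hp0 hp1 (fun ω => (abs_lt.mp (hx ω)).2.le) hx0) hc.le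
  · rw [← norm_toL2_sq]
    refine sq_mul_norm_sq_le_norm_proj_sq (toL2_restrictSphere_mem hL) (by positivity) ?_
    simp only [norm_toL2_sq, inner_toL2, hh, mul_assoc, integral_const_mul, abs_mul, abs_of_pos hc]
    exact mul_le_mul_of_nonneg_left (le_abs.mpr <| .inr <| le_neg.mp <|
      integral_one_sub_rpow_mul_self_le hp0 hp1 hx hx0) hc.le
  · intro l P hl hP
    refine mul_le_mul_of_nonneg_left (abs_integral_one_sub_rpow_mul_le hp0 hp1
      (fun ω => (abs_lt.mp (hx ω)).2) (integral_restrictSphere_eq_zero (by lia) hP)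
      (integral_restrictSphere_mul_eq_zero (by lia) hL hP)) hc.le

theorem bilin_one_sub_smul (hn : 1 ≤ n) (hs : s - (n : ℝ) / 2 ∈ Ioo (0 : ℝ) 1) {f : L2 n}
    (hf : MemHs n s f) (hP : P ∈ solidHarmonics n l) (δ : ℝ) :
    bilin n s f (toL2 n (1 - δ • restrictSphere n P)) =
      alpha n s 0 * inner ℝ f (toL2 n 1) -
        δ * (alpha n s l * inner ℝ f (toL2 n (restrictSphere n P))) := by
  have hY := Submodule.smul_mem _ δ (toL2_restrictSphere_mem hP)
  rw [map_sub, map_smul, bilin_sub_right hn hs hf (memHs_of_mem_sphericalHarmonics toL2_one_mem)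
    (memHs_of_mem_sphericalHarmonics hY), bilin_of_mem_sphericalHarmonics toL2_one_mem,
    bilin_of_mem_sphericalHarmonics hY, real_inner_smul_right]
  ring

theorem memHs_one_sub_smul (hP : P ∈ solidHarmonics n l) (δ : ℝ) :
    MemHs n s (toL2 n (1 - δ • restrictSphere n P)) := by
  rw [map_sub, map_smul]
  exact (memHs_of_mem_sphericalHarmonics toL2_one_mem).sub
    (memHs_of_mem_sphericalHarmonics (Submodule.smul_mem _ δ (toL2_restrictSphere_mem hP)))

theorem quad_one_sub_smul (hn : 1 ≤ n) (hs : s - (n : ℝ) / 2 ∈ Ioo (0 : ℝ) 1) (hl : l ≠ 0)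
    (hP : P ∈ solidHarmonics n l) (δ : ℝ) :
    quad n s (toL2 n (1 - δ • restrictSphere n P)) =
      alpha n s 0 * (surf n).real univ +
        δ ^ 2 * (alpha n s l * ∫ ω, restrictSphere n P ω ^ 2 ∂(surf n)) := by
  have horth : inner ℝ (toL2 n (restrictSphere n P)) (toL2 n 1) = 0 := by
    simpa [inner_toL2] using integral_restrictSphere_eq_zero hl hP
  rw [← bilin_self, bilin_one_sub_smul hn hs (memHs_one_sub_smul hP δ) hP, ← norm_toL2_sq,
    ← norm_toL2_one_sq, map_sub, map_smul, inner_sub_left, inner_sub_left, real_inner_smul_left,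
    real_inner_smul_left, real_inner_comm (toL2 n (restrictSphere n P)) (toL2 n 1), horth,
    real_inner_self_eq_norm_sq, real_inner_self_eq_norm_sq]
  ring

theorem bilin_one_sub_smul_neg (hn : 1 ≤ n) (hs : s - (n : ℝ) / 2 ∈ Ioo (0 : ℝ) 1) (hl : 2 ≤ l)
    (hP : P ∈ solidHarmonics n l) {δ : ℝ}
    (hδ : |δ| * (alpha n s l * ‖restrictSphere n P‖) < -alpha n s 0 * (s - n / 2))
    (hh : h ∈ optimizers n s) (hh' : MemHs n s (toL2 n h)) :
    bilin n s (toL2 n h) (toL2 n (1 - δ • restrictSphere n P)) < 0 := by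
  obtain ⟨c, hc, Q, ⟨-, hQV⟩, ⟨hH, -⟩, -, hY⟩ := exists_integral_optimizer_bounds hs hh
  have hα0 := alpha_zero_neg hs
  have hα := alpha_pos (l := l) hs (by lia)
  have hV := measureReal_surf_pos (n := n)
  rw [bilin_one_sub_smul hn hs hh' hP]
  simp only [inner_toL2, ContinuousMap.one_apply, mul_one]
  calc
    _ ≤ alpha n s 0 * (c * ((s - n / 2) * (surf n).real univ)) +
        |δ| * (alpha n s l * (c * (‖restrictSphere n P‖ * (surf n).real univ))) := by
      refine (sub_eq_add_neg _ _).trans_le (add_le_add (mul_le_mul_of_nonpos_left hH hα0.le) ?_)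
      refine (neg_le_abs _).trans ?_
      rw [abs_mul, abs_mul, abs_of_pos hα]
      have hbound := (hY hl hP).trans <| mul_le_mul_of_nonneg_left
        (mul_le_mul_of_nonneg_left hQV (norm_nonneg _)) hc.le
      gcongr
    _ = c * (surf n).real univ *
        (|δ| * (alpha n s l * ‖restrictSphere n P‖) - -alpha n s 0 * (s - n / 2)) := by ring
    _ < 0 := mul_neg_of_pos_of_neg (by positivity) (sub_neg.mpr hδ)

-- The negative mode alone gives equality up to a cross term of order `|δ| Q`, which the degree-one
-- part of `h`, of order `Q`, absorbs for small `δ`.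
theorem alpha_zero_mul_quad_le_bilin_sq (hn : 1 ≤ n)
    (hs : s - (n : ℝ) / 2 ∈ Ioo (0 : ℝ) 1) (hl : 2 ≤ l) (hP : P ∈ solidHarmonics n l) {δ : ℝ}
    (hδ : 8 * (|δ| * (alpha n s l * ‖restrictSphere n P‖)) ≤ alpha n s 1 * (s - n / 2) ^ 2)
    (hh : h ∈ optimizers n s) (hh' : MemHs n s (toL2 n h)) :
    alpha n s 0 * (surf n).real univ * quad n s (toL2 n h) ≤
      bilin n s (toL2 n h) (toL2 n (1 - δ • restrictSphere n P)) ^ 2 := by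
  obtain ⟨c, hc, Q, ⟨hQ0, -⟩, ⟨hH0, hH1⟩, hproj, hY⟩ := exists_integral_optimizer_bounds hs hh
  have hα0 := alpha_zero_neg hs
  have hα := alpha_pos (l := l) hs (by lia)
  have hV := measureReal_surf_pos (n := n)
  have hquad := alpha_zero_add_alpha_one_le_quad hn hs hh'
  have hproj0 := norm_proj_zero_sq_mul (toL2 n h)
  rw [bilin_one_sub_smul hn hs hh' hP]
  simp only [inner_toL2, ContinuousMap.one_apply, mul_one] at hproj0 ⊢
  set H := ∫ ω, h ω ∂(surf n)
  set Φ := ∫ ω, h ω * restrictSphere n P ω ∂(surf n)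
  have hΦ : |Φ| ≤ c * (‖restrictSphere n P‖ * Q) := hY hl hP
  have hcross : |H * (δ * (alpha n s l * Φ))| ≤
      c * (surf n).real univ * (|δ| * (alpha n s l * (c * (‖restrictSphere n P‖ * Q)))) := by
    rw [abs_mul, abs_mul, abs_mul, abs_of_pos hα, abs_of_nonneg (hH0.trans' <| by
      have := hs.1.le; positivity)]
    gcongr
  calc
    _ ≤ alpha n s 0 * (surf n).real univ * (alpha n s 0 * ‖proj n 0 (toL2 n h)‖ ^ 2 +
        alpha n s 1 * ((c * ((s - n / 2) / 2)) ^ 2 * Q)) := by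
      refine mul_le_mul_of_nonpos_left (hquad.trans' ?_) (mul_neg_of_neg_of_pos hα0 hV).le
      gcongr
      exact (alpha_pos hs one_ne_zero).le
    _ = (alpha n s 0 * H) ^ 2 + alpha n s 0 * (c ^ 2 * (surf n).real univ * Q / 4) *
        (alpha n s 1 * (s - n / 2) ^ 2) := by
      linear_combination alpha n s 0 ^ 2 * hproj0
    _ ≤ (alpha n s 0 * H) ^ 2 + alpha n s 0 * (c ^ 2 * (surf n).real univ * Q / 4) *
        (8 * (|δ| * (alpha n s l * ‖restrictSphere n P‖))) :=
      add_le_add le_rfl (mul_le_mul_of_nonpos_left hδ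
        (mul_nonpos_of_nonpos_of_nonneg hα0.le (by positivity)))
    _ = (alpha n s 0 * H) ^ 2 + 2 * alpha n s 0 *
        (c * (surf n).real univ * (|δ| * (alpha n s l * (c * (‖restrictSphere n P‖ * Q))))) := by
      ring
    _ ≤ (alpha n s 0 * H) ^ 2 + 2 * alpha n s 0 * -(H * (δ * (alpha n s l * Φ))) :=
      add_le_add le_rfl
        (mul_le_mul_of_nonpos_left ((neg_le_abs _).trans hcross) (by linarith))
    _ ≤ (alpha n s 0 * H - δ * (alpha n s l * Φ)) ^ 2 := by
      nlinarith [sq_nonneg (δ * (alpha n s l * Φ))]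

theorem eventually_coe_le_stabDist (hn : 1 ≤ n) (hs : s - (n : ℝ) / 2 ∈ Ioo (0 : ℝ) 1)
    (hl : 2 ≤ l) (hP : P ∈ solidHarmonics n l) :
    ∀ᶠ δ in 𝓝 (0 : ℝ),
      ((δ ^ 2 * (alpha n s l * ∫ ω, restrictSphere n P ω ^ 2 ∂(surf n)) : ℝ) : EReal) ≤
        stabDist n s (1 - δ • restrictSphere n P) := by
  have hlim : Tendsto (fun δ : ℝ => |δ| * (alpha n s l * ‖restrictSphere n P‖)) (𝓝 0) (𝓝 0) :=
    Continuous.tendsto' (by fun_prop) _ _ (by simp)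
  have hneg : 0 < -alpha n s 0 * (s - n / 2) := mul_pos (neg_pos.mpr (alpha_zero_neg hs)) hs.1
  have hpos : 0 < alpha n s 1 * (s - n / 2) ^ 2 / 8 := by
    have := alpha_pos hs one_ne_zero
    have := hs.1
    positivity
  filter_upwards [hlim.eventually_lt_const hneg, hlim.eventually_le_const hpos] with δ hδ hδ8
  have hdist := coe_quad_sub_le_stabDist hn hs (memHs_one_sub_smul hP δ) fun h hh hh' =>
    ⟨bilin_one_sub_smul_neg hn hs hl hP hδ hh hh',
      alpha_zero_mul_quad_le_bilin_sq hn hs hl hP (by linarith) hh hh'⟩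
  rwa [quad_one_sub_smul hn hs (by lia) hP, add_sub_cancel_left] at hdist

end Distance

section Deficit

theorem measureReal_surf (n : ℕ) :
    (surf n).real univ = 2 * √Real.pi ^ (n + 1) / Real.Gamma (n / 2 + 1 / 2) := by
  have hGamma : Real.Gamma (((n : ℝ) + 1) / 2 + 1) =
      (n + 1) / 2 * Real.Gamma (n / 2 + 1 / 2) := by
    rw [Real.Gamma_add_one (by positivity), add_div]
  rw [Measure.toSphere_real_apply_univ, measureReal_def, EuclideanSpace.volume_ball]
  simp only [finrank_euclideanSpace, Fintype.card_fin, ENNReal.ofReal_one, one_pow, one_mul]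
  push_cast
  rw [hGamma, ENNReal.toReal_ofReal (by positivity)]
  field_simp

theorem measureReal_surf_eq_mul_Gamma_div {n : ℕ} (hn : n ≠ 0) :
    (surf n).real univ =
      (4 * Real.pi) ^ ((n : ℝ) / 2) * (Real.Gamma (n / 2) / Real.Gamma n) := by
  have hpow : (4 * Real.pi) ^ ((n : ℝ) / 2) = 2 ^ n * √Real.pi ^ n := by
    rw [← Real.rpow_natCast, ← Real.rpow_natCast, ← Real.mul_rpow two_pos.le (Real.sqrt_nonneg _),
      Real.rpow_div_two_eq_sqrt _ (by positivity), Real.sqrt_mul zero_le_four,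
      show √4 = (2 : ℝ) by rw [Real.sqrt_eq_iff_mul_self_eq] <;> norm_num]
  have hduplication := Real.Gamma_mul_Gamma_add_half ((n : ℝ) / 2)
  rw [mul_div_cancel₀ (n : ℝ) two_ne_zero, Real.rpow_sub two_pos, Real.rpow_one,
    Real.rpow_natCast] at hduplication
  rw [measureReal_surf, hpow]
  field_simp at hduplication ⊢
  rw [pow_succ]
  linear_combination -√Real.pi ^ n * hduplication

theorem sobolevConst_mul_rpow {n : ℕ} (hn : n ≠ 0) (s : ℝ) :
    sobolevConst n s * (surf n).real univ ^ (((n : ℝ) - 2 * s) / n) =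
      alpha n s 0 * (surf n).real univ := by
  have hn' : (0 : ℝ) < n := Nat.cast_pos.mpr hn.bot_lt
  have hratio : 0 < Real.Gamma ((n : ℝ) / 2) / Real.Gamma n :=
    div_pos (Real.Gamma_pos_of_pos (by positivity)) (Real.Gamma_pos_of_pos hn')
  have hconst : sobolevConst n s = alpha n s 0 * (surf n).real univ ^ (2 * s / n) := by
    rw [measureReal_surf_eq_mul_Gamma_div hn, Real.mul_rpow (by positivity) hratio.le,
      ← Real.rpow_mul (by positivity), show (n : ℝ) / 2 * (2 * s / n) = s by field_simp,
      sobolevConst, alpha, Nat.cast_zero, zero_add, add_div, sub_div,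
      mul_div_cancel_left₀ s two_ne_zero]
    ring
  rw [hconst, mul_assoc, ← Real.rpow_add measureReal_surf_pos, ← add_div, add_sub_cancel,
    div_self hn'.ne', Real.rpow_one]

theorem sobolevConst_neg {n : ℕ} {s : ℝ} (hn : n ≠ 0) (hs : s - (n : ℝ) / 2 ∈ Ioo (0 : ℝ) 1) :
    sobolevConst n s < 0 := by
  have hprod : sobolevConst n s * (surf n).real univ ^ (((n : ℝ) - 2 * s) / n) < 0 := by
    rw [sobolevConst_mul_rpow hn]
    exact mul_neg_of_neg_of_pos (alpha_zero_neg hs) measureReal_surf_pos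
  exact neg_of_mul_neg_left hprod (Real.rpow_nonneg measureReal_surf_pos.le _)

theorem eventually_mul_lt_one {α : Type*} [TopologicalSpace α] [CompactSpace α]
    (φ : C(α, ℝ)) : ∀ᶠ δ in 𝓝 (0 : ℝ), ∀ ω, δ * φ ω < 1 := by
  have hlim : Tendsto (fun δ : ℝ => ‖δ • φ‖) (𝓝 0) (𝓝 0) :=
    Continuous.tendsto' (by fun_prop) _ _ (by simp)
  filter_upwards [hlim.eventually_lt_const one_pos] with δ hδ ω
  exact (le_abs_self _).trans_lt (((δ • φ).norm_coe_le_norm ω).trans_lt hδ)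

section Expansion

variable {α : Type*} [TopologicalSpace α] [CompactSpace α] [MeasurableSpace α]
  [OpensMeasurableSpace α] {μ : Measure α} [IsFiniteMeasure μ] {φ : C(α, ℝ)} {q : ℝ}

theorem integral_sq_pos_of_integral_cube_pos (hφ : 0 < ∫ ω, φ ω ^ 3 ∂μ) :
    0 < ∫ ω, φ ω ^ 2 ∂μ := by
  refine pos_of_mul_pos_right (a := ‖φ‖) (hφ.trans_le ?_) (norm_nonneg _)
  rw [← integral_const_mul]
  refine integral_mono (integrable_of_compactSpace (by fun_prop))
    (integrable_of_compactSpace (by fun_prop)) fun ω => ?_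
  rw [pow_succ']
  exact mul_le_mul_of_nonneg_right ((le_abs_self _).trans (φ.norm_coe_le_norm ω)) (sq_nonneg _)

theorem cubic_le_integral_one_sub_mul_rpow (hq : q ≤ 0) (hφ : ∀ ω, φ ω < 1)
    (hφ0 : ∫ ω, φ ω ∂μ = 0) :
    μ.real univ + q * (q - 1) / 2 * ∫ ω, φ ω ^ 2 ∂μ +
        q * (q - 1) * (2 - q) / 6 * ∫ ω, φ ω ^ 3 ∂μ ≤
      ∫ ω, (1 - φ ω) ^ q ∂μ := by
  have hsq : Integrable (fun ω => q * (q - 1) / 2 * φ ω ^ 2) μ :=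
    integrable_of_compactSpace (by fun_prop)
  have hcube : Integrable (fun ω => q * (q - 1) * (2 - q) / 6 * φ ω ^ 3) μ :=
    integrable_of_compactSpace (by fun_prop)
  have hlin : Integrable (fun ω => 1 - q * φ ω) μ := integrable_of_compactSpace (by fun_prop)
  have hrpow : Integrable (fun ω => (1 - φ ω) ^ q) μ := integrable_of_compactSpace <|
    Continuous.rpow_const (by fun_prop) fun ω => Or.inl (sub_pos.mpr (hφ ω)).ne'
  calc
    _ = ∫ ω, (1 - q * φ ω + q * (q - 1) / 2 * φ ω ^ 2 +
        q * (q - 1) * (2 - q) / 6 * φ ω ^ 3) ∂μ := by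
      rw [integral_add (by exact hlin.add hsq) hcube, integral_add hlin hsq,
        integral_one_sub_mul hφ0, integral_const_mul, integral_const_mul]
    _ ≤ _ := integral_mono ((hlin.add hsq).add hcube) hrpow fun ω => by
      have hcubic := cubic_le_rpow_one_add hq (neg_lt_neg (hφ ω))
      rw [← sub_eq_add_neg] at hcubic
      exact hcubic.trans' (le_of_eq (by ring))

theorem eventually_integral_one_sub_mul_rpow_lt (hq : q ≤ -2) (hφ : ∫ ω, φ ω ∂μ = 0)
    (hφ3 : 0 < ∫ ω, φ ω ^ 3 ∂μ) :
    ∀ᶠ δ in 𝓝[>] (0 : ℝ), (∫ ω, (1 - δ * φ ω) ^ q ∂μ) ^ (2 / q) <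
      μ.real univ ^ (2 / q) *
        (1 - (1 - q) * (δ ^ 2 * ((∫ ω, φ ω ^ 2 ∂μ) / μ.real univ))) := by
  have : NeZero μ := ⟨by rintro rfl; simp at hφ3⟩
  have hV : 0 < μ.real univ := measureReal_univ_pos
  have hq0 : q < 0 := by linarith
  have hqq : 0 < q * (q - 1) := mul_pos_of_neg_of_neg hq0 (by linarith)
  have hq2 : 0 < 2 - q := by linarith
  set b := q * (q - 1) / 2 * ((∫ ω, φ ω ^ 2 ∂μ) / μ.real univ) with hb
  set c := q * (q - 1) * (2 - q) / 6 * ((∫ ω, φ ω ^ 3 ∂μ) / μ.real univ) with hc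
  have hb0 : 0 ≤ b := by positivity
  have hp0 : -1 ≤ 2 / q := by
    rw [le_div_iff_of_neg hq0]
    linarith
  have hp1 : 2 / q < 0 := div_neg_of_pos_of_neg two_pos hq0
  filter_upwards [eventually_rpow_one_add_lt hp0 hp1 hb0 (by positivity : 0 < c),
    (eventually_mul_lt_one φ).filter_mono nhdsWithin_le_nhds, self_mem_nhdsWithin]
    with δ hδ hlt (hδ0 : 0 < δ)
  have hcubic : μ.real univ * (1 + (b * δ ^ 2 + c * δ ^ 3)) ≤ ∫ ω, (1 - δ * φ ω) ^ q ∂μ := by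
    have h := cubic_le_integral_one_sub_mul_rpow (μ := μ) (φ := δ • φ) hq0.le hlt
      (by simp [integral_const_mul, hφ])
    simp only [ContinuousMap.smul_apply, smul_eq_mul, mul_pow, integral_const_mul] at h
    refine h.trans' (le_of_eq ?_)
    rw [hb, hc]
    field_simp
    ring
  calc
    _ ≤ (μ.real univ * (1 + (b * δ ^ 2 + c * δ ^ 3))) ^ (2 / q) :=
      Real.rpow_le_rpow_of_nonpos (by positivity) hcubic hp1.le
    _ = μ.real univ ^ (2 / q) * (1 + (b * δ ^ 2 + c * δ ^ 3)) ^ (2 / q) :=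
      Real.mul_rpow hV.le (by positivity)
    _ < μ.real univ ^ (2 / q) * (1 + 2 / q * (b * δ ^ 2)) :=
      mul_lt_mul_of_pos_left hδ (Real.rpow_pos_of_pos hV _)
    _ = _ := by
      rw [hb]
      field_simp [hq0.ne]
      ring

end Expansion

theorem powNorm_sq {n : ℕ} {q : ℝ} {u : C(Sph n, ℝ)} (hu : ∀ ω, 0 ≤ u ω) :
    powNorm n q u ^ 2 = (∫ ω, u ω ^ q ∂(surf n)) ^ (2 / q) := by
  rw [powNorm, ← Real.rpow_mul_natCast (integral_nonneg fun ω => Real.rpow_nonneg (hu ω) q),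
    Nat.cast_ofNat, one_div_mul_eq_div]

theorem eventually_lt_sobolevConst_mul_powNorm_sq {n : ℕ} {s : ℝ} (hn : 2 ≤ n)
    (hs : s - (n : ℝ) / 2 ∈ Ioo (0 : ℝ) 1) {φ : C(Sph n, ℝ)} (hφ : ∫ ω, φ ω ∂(surf n) = 0)
    (hφ3 : 0 < ∫ ω, φ ω ^ 3 ∂(surf n)) :
    ∀ᶠ δ in 𝓝[>] (0 : ℝ),
      alpha n s 0 * (surf n).real univ + δ ^ 2 * (alpha n s 1 * ∫ ω, φ ω ^ 2 ∂(surf n)) <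
        sobolevConst n s * powNorm n (2 * n / (n - 2 * s)) (1 - δ • φ) ^ 2 := by
  have hn2 : (2 : ℝ) ≤ n := mod_cast hn
  have hsub : (n : ℝ) - 2 * s < 0 := by linarith [hs.1]
  have hq : 2 * n / (n - 2 * s) ≤ -2 := by
    rw [div_le_iff_of_neg hsub]
    linarith [hs.2]
  have hexp : 2 / (2 * n / (n - 2 * s)) = ((n : ℝ) - 2 * s) / n := by
    rw [div_div_eq_mul_div, mul_div_mul_left _ _ two_ne_zero]
  have halpha : alpha n s 0 * (1 - 2 * n / (n - 2 * s)) = -alpha n s 1 := by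
    have h := alpha_succ hs 0
    simp only [Nat.cast_zero, zero_add] at h
    field_simp [hsub.ne]
    linear_combination 2 * h
  filter_upwards [eventually_integral_one_sub_mul_rpow_lt hq hφ hφ3,
    (eventually_mul_lt_one φ).filter_mono nhdsWithin_le_nhds] with δ hδ hlt
  rw [powNorm_sq fun ω => (sub_pos.mpr (hlt ω)).le]
  refine (mul_lt_mul_of_neg_left hδ (sobolevConst_neg (by lia) hs)).trans_eq' ?_
  rw [hexp, ← mul_assoc, sobolevConst_mul_rpow (by lia)]
  have hV := (measureReal_surf_pos (n := n)).ne'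
  field_simp
  linear_combination -δ ^ 2 * (∫ ω, φ ω ^ 2 ∂(surf n)) * halpha

end Deficit

section Stability

variable {n l : ℕ} {s : ℝ} {P : MvPolynomial (Fin (n + 1)) ℝ}

theorem coe_div_lt_coe_of_le {x κ D : ℝ} {d : EReal} (hκ : 0 < κ) (hD : 0 < D)
    (hd : (D : EReal) ≤ d) (hx : x < κ * D) : (x : EReal) / d < (κ : EReal) := by
  induction d with
  | bot => simp at hd
  | top => simpa using hκ
  | coe t =>
    have ht : D ≤ t := EReal.coe_le_coe_iff.mp hd
    rw [← EReal.coe_div, EReal.coe_lt_coe_iff, div_lt_iff₀ (hD.trans_le ht)]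
    exact hx.trans_le (mul_le_mul_of_nonneg_left ht hκ.le)

theorem cBE_lt_of_integral_cube_pos (hn : 2 ≤ n) (hs : s - (n : ℝ) / 2 ∈ Ioo (0 : ℝ) 1)
    (hl : 2 ≤ l) (hP : P ∈ solidHarmonics n l)
    (hcube : 0 < ∫ ω, restrictSphere n P ω ^ 3 ∂(surf n)) :
    cBE n s < ((1 - alpha n s 1 / alpha n s l : ℝ) : EReal) := by
  have hα := alpha_pos (l := l) hs (by lia)
  have hgap : alpha n s 1 < alpha n s l := by
    obtain ⟨k, rfl⟩ := Nat.exists_eq_add_of_le' (by lia : 1 ≤ l)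
    exact strictMono_alpha_succ hs (by lia : 0 < k)
  obtain ⟨δ, hdeficit, hdist, hlt, hδ : 0 < δ⟩ :=
    ((eventually_lt_sobolevConst_mul_powNorm_sq hn hs
      (integral_restrictSphere_eq_zero (by lia) hP) hcube).and <|
      ((eventually_coe_le_stabDist (by lia) hs hl hP).filter_mono nhdsWithin_le_nhds).and <|
      ((eventually_mul_lt_one (restrictSphere n P)).filter_mono nhdsWithin_le_nhds).and
      self_mem_nhdsWithin).exists
  have hD : 0 < δ ^ 2 * (alpha n s l * ∫ ω, restrictSphere n P ω ^ 2 ∂(surf n)) :=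
    mul_pos (pow_pos hδ 2) (mul_pos hα (integral_sq_pos_of_integral_cube_pos hcube))
  have hopt : 1 - δ • restrictSphere n P ∉ optimizers n s := fun h =>
    (EReal.coe_pos.mpr hD).not_ge (hdist.trans (stabDist_nonpos_of_mem_optimizers h))
  have hadmissible : 1 - δ • restrictSphere n P ∈ admissible n s :=
    ⟨memHs_one_sub_smul hP δ, fun ω => sub_pos.mpr (hlt ω), hopt⟩
  refine sInf_lt_iff.mpr ⟨_, mem_image_of_mem _ hadmissible, coe_div_lt_coe_of_le
    (sub_pos.mpr ((div_lt_one hα).mpr hgap)) hD hdist ?_⟩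
  rw [quad_one_sub_smul (by lia) hs (by lia) hP, one_sub_mul, div_mul_eq_mul_div,
    show alpha n s 1 * (δ ^ 2 * (alpha n s l * ∫ ω, restrictSphere n P ω ^ 2 ∂(surf n))) /
      alpha n s l = δ ^ 2 * (alpha n s 1 * ∫ ω, restrictSphere n P ω ^ 2 ∂(surf n)) by field_simp]
  linarith

theorem one_sub_alpha_one_div_alpha_two (hs : s - (n : ℝ) / 2 ∈ Ioo (0 : ℝ) 1) :
    1 - alpha n s 1 / alpha n s 2 = 4 * s / (n + 2 * s + 2) := by
  have hα : alpha n s 2 ≠ 0 := (alpha_pos hs two_ne_zero).ne'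
  have hden : (n : ℝ) + 2 * s + 2 ≠ 0 := by linarith [hs.1, n.cast_nonneg (α := ℝ)]
  have h := alpha_succ hs 1
  simp only [Nat.cast_one, Nat.reduceAdd] at h
  rw [one_sub_div hα, div_eq_div_iff hα hden]
  linear_combination 2 * h

end Stability

end ReverseSobolev

theorem theorem2 (n : ℕ) (hn : 2 ≤ n) (s : ℝ) (hs : s - (n : ℝ) / 2 ∈ Set.Ioo (0 : ℝ) 1) :
    ReverseSobolev.cBE n s < ((4 * s / ((n : ℝ) + 2 * s + 2) : ℝ) : EReal) := by
  open ReverseSobolev in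
  obtain ⟨i, j, k, hij, hjk, hki⟩ : ∃ i j k : Fin (n + 1), i ≠ j ∧ j ≠ k ∧ k ≠ i :=
    ⟨⟨0, by lia⟩, ⟨1, by lia⟩, ⟨2, by lia⟩, by simp, by simp, by simp⟩
  rw [← one_sub_alpha_one_div_alpha_two hs]
  exact cBE_lt_of_integral_cube_pos hn hs le_rfl (pairSum_mem_solidHarmonics hij hjk hki)
    (integral_pairSum_cube_pos hij hjk hki)
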